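/- Let $\mathbb K$ be a field with a nontrivial non-Archimedean absolute value. Let $A$ be a (non-Archimedean) Banach algebra over $\mathbb K$ that is polar (for each $y\in A$ with $\|y\|>1$ there is a continuous linear functional $f$ with $|f(x)|\le 1$ whenever $\|x\|\le 1$, and $|f(y)|>1$), has nondegenerate product ($ab=0$ for all $b$ implies $a=0$; $ab=0$ for all $a$ implies $b=0$), and possesses a bounded approximate identity. Let $\widehat\otimes$ be the completed tensor product for the norm $\|g\|=\inf\max_i\|x_i\|\,\|y_i\|$ over all representations $g=\sum_i x_i\otimes y_i$, and let $M(B)$ be the algebra of multipliers of a Banach algebra $B$, i.e. of pairs of continuous linear maps $b\mapsto mb$, $b\mapsto bm$ with $(bm)b'=b(mb')$. Let $(A,\Delta)$ be a regular multiplier Banach-Hopf algebra: $\Delta:A\to M(A\widehat\otimes A)$ is a continuous homomorphism, nondegenerate in the sense that the spans of $\{\Delta(a)w\}$ and of $\{w\Delta(a)\}$ ($a\in A$, $w\in A\widehat\otimes A$) are dense in $A\widehat\otimes A$; it is coassociative, $(\Delta\otimes\mathrm{id})\Delta=(\mathrm{id}\otimes\Delta)\Delta$, the maps $\Delta\otimes\mathrm{id}$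 and $\mathrm{id}\otimes\Delta$ being extended to $M(A\widehat\otimes A)$; and the assignments $$T_1(a\otimes b)=\Delta(a)(1\otimes b),\quad T_2(a\otimes b)=(a\otimes 1)\Delta(b),\quad T_3(a\otimes b)=(1\otimes b)\Delta(a),\quad T_4(a\otimes b)=\Delta(b)(a\otimes 1)$$ take values in $A\widehat\otimes A$ and extend to bijective linear isometries of $A\widehat\otimes A$. The counit $\varepsilon:A\to\mathbb K$ is defined by $\varepsilon(a)b=m\,T_1^{-1}(a\otimes b)$, where $m(a\otimes b)=ab$, and the antipode $S:A\to A$ by $S(a)b=(\varepsilon\otimes\mathrm{id})T_1^{-1}(a\otimes b)$. The homomorphisms $\Delta,\varepsilon$ and the anti-homomorphism $S$ are extended to $M(A)$. Let $\varphi:A\to\mathbb K$ be a nonzero continuous linear functional that is left-invariant: $(\mathrm{id}\otimes\varphi)\Delta(a)=\varphi(a)1$ in $M(A)$, that is, $(\mathrm{id}\otimes\varphi)(\Delta(a)(b\otimes1))=\varphi(a)b=(\mathrm{id}\otimes\varphi)((b\otimes1)\Delta(a))$ for all $a,b\in A$. Then there is a multiplier $\delta\in M(A)$ such that $(\varphi\otimes\mathrm{id})\Delta(a)=\varphi(a)\delta$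 for all $a\in A$, that is, for all $a,b\in A$, $$(\varphi\otimes\mathrm{id})((1\otimes b)\Delta(a))=\varphi(a)\,b\delta,\qquad (\varphi\otimes\mathrm{id})(\Delta(a)(1\otimes b))=\varphi(a)\,\delta b .$$ This $\delta$ is invertible in $M(A)$ and satisfies $\Delta(\delta)=\delta\otimes\delta$, $\varepsilon(\delta)=1$ and $S(\delta)=\delta^{-1}$. Moreover $\varphi(S(a))=\varphi(a\delta)$ for all $a\in A$. -/

import Mathlib

open scoped TensorProduct MultiplierAlgebra

noncomputable section

namespace NABanach

/-! ### The completed tensor product of non-Archimedean normed spaces -/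

section TensorNorm

variable (𝕜 E F : Type*) [NontriviallyNormedField 𝕜]
  [NormedAddCommGroup E] [NormedSpace 𝕜 E] [NormedAddCommGroup F] [NormedSpace 𝕜 F]

/-- The algebraic tensor product, to be equipped with the non-Archimedean tensor norm. -/
def AlgTensor : Type _ := E ⊗[𝕜] F

instance : AddCommGroup (AlgTensor 𝕜 E F) := inferInstanceAs (AddCommGroup (E ⊗[𝕜] F))
instance : Module 𝕜 (AlgTensor 𝕜 E F) := inferInstanceAs (Module 𝕜 (E ⊗[𝕜] F))

variable {𝕜 E F}

/-- The elementary tensor `x ⊗ y` in the algebraic tensor product. -/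
def AlgTensor.tmul (x : E) (y : F) : AlgTensor 𝕜 E F := x ⊗ₜ[𝕜] y

/-- `c` is an upper bound of `max ‖xᵢ‖ ‖yᵢ‖` for some representation `g = ∑ xᵢ ⊗ yᵢ`. -/
def AlgTensor.IsBound (g : AlgTensor 𝕜 E F) (c : ℝ) : Prop :=
  0 ≤ c ∧ ∃ l : List (E × F), g = (l.map fun p => AlgTensor.tmul p.1 p.2).sum ∧
    ∀ p ∈ l, ‖p.1‖ * ‖p.2‖ ≤ c

theorem AlgTensor.exists_isBound (g : AlgTensor 𝕜 E F) : ∃ c, g.IsBound c := by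
  refine TensorProduct.induction_on (motive := fun g => ∃ c, AlgTensor.IsBound (𝕜 := 𝕜) g c)
    g ?_ ?_ ?_
  · exact ⟨0, le_rfl, [], rfl, by simp⟩
  · intro x y
    refine ⟨‖x‖ * ‖y‖, by positivity, [(x, y)], ?_, by simp⟩
    simp only [List.map_cons, List.map_nil, List.sum_cons, List.sum_nil, add_zero]
    rfl
  · rintro g h ⟨c, hc, l, rfl, hl⟩ ⟨d, hd, l', rfl, hl'⟩
    refine ⟨max c d, le_max_of_le_left hc, l ++ l', ?_, ?_⟩
    · rw [List.map_append, List.sum_append]; rfl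
    · intro p hp
      rcases List.mem_append.1 hp with h | h
      · exact (hl p h).trans (le_max_left _ _)
      · exact (hl' p h).trans (le_max_right _ _)

theorem AlgTensor.IsBound.add {g h : AlgTensor 𝕜 E F} {c d : ℝ} (hg : g.IsBound c)
    (hh : h.IsBound d) : (g + h).IsBound (max c d) := by
  obtain ⟨hc, l, rfl, hl⟩ := hg
  obtain ⟨hd, l', rfl, hl'⟩ := hh
  refine ⟨le_max_of_le_left hc, l ++ l', ?_, ?_⟩
  · rw [List.map_append, List.sum_append]
  · intro p hp
    rcases List.mem_append.1 hp with h | h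
    · exact (hl p h).trans (le_max_left _ _)
    · exact (hl' p h).trans (le_max_right _ _)

theorem AlgTensor.IsBound.smul {g : AlgTensor 𝕜 E F} {c : ℝ} (hg : g.IsBound c) (k : 𝕜) :
    (k • g).IsBound (‖k‖ * c) := by
  obtain ⟨hc, l, rfl, hl⟩ := hg
  refine ⟨by positivity, l.map fun p => (k • p.1, p.2), ?_, ?_⟩
  · rw [List.smul_sum, List.map_map, List.map_map]
    rfl
  · intro p hp
    obtain ⟨q, hq, rfl⟩ := List.mem_map.1 hp
    simp only [norm_smul, mul_assoc]
    exact mul_le_mul_of_nonneg_left (hl q hq) (norm_nonneg k)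

/-- The tensor norm `‖g‖ = inf max ‖xᵢ‖ ‖yᵢ‖` over all representations `g = ∑ xᵢ ⊗ yᵢ`. -/
instance : Norm (AlgTensor 𝕜 E F) := ⟨fun g => sInf {c | g.IsBound c}⟩

theorem AlgTensor.bddBelow (g : AlgTensor 𝕜 E F) : BddBelow {c | g.IsBound c} :=
  ⟨0, fun _ hc => hc.1⟩

theorem AlgTensor.norm_le {g : AlgTensor 𝕜 E F} {c : ℝ} (h : g.IsBound c) : ‖g‖ ≤ c :=
  csInf_le g.bddBelow h

theorem AlgTensor.exists_lt {g : AlgTensor 𝕜 E F} {c : ℝ} (h : ‖g‖ < c) :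
    ∃ d, g.IsBound d ∧ d < c := by
  obtain ⟨d, hd, h⟩ := exists_lt_of_csInf_lt g.exists_isBound h
  exact ⟨d, hd, h⟩

theorem AlgTensor.norm_nonneg' (g : AlgTensor 𝕜 E F) : 0 ≤ ‖g‖ :=
  le_csInf g.exists_isBound fun _ hc => hc.1

theorem AlgTensor.norm_add_le_max (g h : AlgTensor 𝕜 E F) : ‖g + h‖ ≤ max ‖g‖ ‖h‖ := by
  refine le_of_forall_gt_imp_ge_of_dense fun c hc => ?_
  obtain ⟨d, hd, hdc⟩ := AlgTensor.exists_lt ((le_max_left _ _).trans_lt hc)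
  obtain ⟨e, he, hec⟩ := AlgTensor.exists_lt ((le_max_right _ _).trans_lt hc)
  exact (AlgTensor.norm_le (hd.add he)).trans (max_le hdc.le hec.le)

theorem AlgTensor.norm_smul_le' (k : 𝕜) (g : AlgTensor 𝕜 E F) : ‖k • g‖ ≤ ‖k‖ * ‖g‖ := by
  have key : ∀ d, g.IsBound d → ‖k • g‖ ≤ ‖k‖ * d := fun d hd => AlgTensor.norm_le (hd.smul k)
  rcases eq_or_lt_of_le (norm_nonneg k) with hk | hk
  · obtain ⟨d, hd⟩ := g.exists_isBound
    simpa [← hk] using key d hd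
  · rw [← div_le_iff₀' hk]
    refine le_csInf g.exists_isBound fun d hd => ?_
    rw [div_le_iff₀' hk]
    exact key d hd

theorem AlgTensor.norm_neg_le (g : AlgTensor 𝕜 E F) : ‖-g‖ ≤ ‖g‖ := by
  simpa using AlgTensor.norm_smul_le' (-1 : 𝕜) g

instance : SeminormedAddCommGroup (AlgTensor 𝕜 E F) :=
  SeminormedAddCommGroup.ofCore (𝕜 := 𝕜)
    { norm_nonneg := AlgTensor.norm_nonneg'
      norm_smul := fun k g => by
        refine le_antisymm (AlgTensor.norm_smul_le' k g) ?_
        rcases eq_or_ne k 0 with rfl | hk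
        · simpa using AlgTensor.norm_nonneg' _
        · have h := AlgTensor.norm_smul_le' k⁻¹ (k • g)
          rw [inv_smul_smul₀ hk, norm_inv] at h
          have hk' := norm_pos_iff.2 hk
          calc ‖k‖ * ‖g‖ ≤ ‖k‖ * (‖k‖⁻¹ * ‖k • g‖) := by gcongr
            _ = ‖k • g‖ := by field_simp
      norm_triangle := fun g h => (AlgTensor.norm_add_le_max g h).trans
        (max_le_add_of_nonneg (AlgTensor.norm_nonneg' g) (AlgTensor.norm_nonneg' h)) }

instance : NormedSpace 𝕜 (AlgTensor 𝕜 E F) where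
  norm_smul_le := AlgTensor.norm_smul_le'

variable (𝕜 E F)

/-- The completed tensor product of two normed spaces. -/
abbrev CTensor : Type _ := UniformSpace.Completion (AlgTensor 𝕜 E F)

end TensorNorm

/-! ### Continuous bilinear maps on the completed tensor product -/

section Lift

instance completion_isUltrametricDist {X : Type*} [SeminormedAddCommGroup X]
    [h : Fact (∀ x y : X, ‖x + y‖ ≤ max ‖x‖ ‖y‖)] :
    IsUltrametricDist (UniformSpace.Completion X) :=
  IsUltrametricDist.isUltrametricDist_of_forall_norm_add_le_max_norm fun x y =>
    UniformSpace.Completion.induction_on₂ x y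
      (isClosed_le (by fun_prop) (by fun_prop)) fun a b => by
        rw [← UniformSpace.Completion.coe_add]
        simpa only [UniformSpace.Completion.norm_coe] using h.out a b

variable {𝕜 E F G E' F' : Type*} [NontriviallyNormedField 𝕜]
  [NormedAddCommGroup E] [NormedSpace 𝕜 E] [NormedAddCommGroup F] [NormedSpace 𝕜 F]
  [NormedAddCommGroup E'] [NormedSpace 𝕜 E'] [NormedAddCommGroup F'] [NormedSpace 𝕜 F']
  [NormedAddCommGroup G] [NormedSpace 𝕜 G]

instance : Fact (∀ x y : AlgTensor 𝕜 E F, ‖x + y‖ ≤ max ‖x‖ ‖y‖) :=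
  ⟨AlgTensor.norm_add_le_max⟩

instance clm_isUltrametricDist [IsUltrametricDist F] : IsUltrametricDist (E →L[𝕜] F) :=
  IsUltrametricDist.isUltrametricDist_of_forall_norm_add_le_max_norm fun f g =>
    ContinuousLinearMap.opNorm_le_bound _ (le_max_of_le_left (norm_nonneg f)) fun x => by
      rw [max_mul_of_nonneg _ _ (norm_nonneg x)]
      exact (IsUltrametricDist.norm_add_le_max _ _).trans
        (max_le_max (f.le_opNorm x) (g.le_opNorm x))

/-- The canonical continuous bilinear map `(x, y) ↦ x ⊗ y`. -/
def tmulL : E →L[𝕜] F →L[𝕜] CTensor 𝕜 E F :=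
  LinearMap.mkContinuous₂
    (LinearMap.mk₂ 𝕜 (fun x y => ((AlgTensor.tmul x y : AlgTensor 𝕜 E F) : CTensor 𝕜 E F))
      (fun x x' y => by
        rw [← UniformSpace.Completion.coe_add]; exact congrArg _ (TensorProduct.add_tmul x x' y))
      (fun k x y => by
        rw [← UniformSpace.Completion.coe_smul]
        exact congrArg _ (TensorProduct.smul_tmul' k x y).symm)
      (fun x y y' => by
        rw [← UniformSpace.Completion.coe_add]; exact congrArg _ (TensorProduct.tmul_add x y y'))
      (fun k x y => by
        rw [← UniformSpace.Completion.coe_smul]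
        exact congrArg _ (TensorProduct.tmul_smul k x y)))
    1 fun x y => by
      rw [LinearMap.mk₂_apply, UniformSpace.Completion.norm_coe, one_mul]
      refine AlgTensor.norm_le ⟨by positivity, [(x, y)], ?_, by simp⟩
      simp

/-- The elementary tensor `x ⊗ y` in the completed tensor product. -/
abbrev tmul (x : E) (y : F) : CTensor 𝕜 E F := tmulL x y

theorem norm_tmul_le (x : E) (y : F) : ‖(tmul x y : CTensor 𝕜 E F)‖ ≤ ‖x‖ * ‖y‖ := by
  refine (UniformSpace.Completion.norm_coe _).trans_le ?_
  exact AlgTensor.norm_le ⟨by positivity, [(x, y)], by simp, by simp⟩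

/-- Linear functionals and operators on `CTensor` are determined by elementary tensors. -/
theorem CTensor.ext_clm {f g : CTensor 𝕜 E F →L[𝕜] G} (h : ∀ x y, f (tmul x y) = g (tmul x y)) :
    f = g := by
  ext z
  refine UniformSpace.Completion.induction_on z (isClosed_eq f.continuous g.continuous) fun t => ?_
  let i : AlgTensor 𝕜 E F →ₗ[𝕜] CTensor 𝕜 E F :=
    (UniformSpace.Completion.toComplL (𝕜 := 𝕜)).toLinearMap
  have e : (f.toLinearMap.comp i : E ⊗[𝕜] F →ₗ[𝕜] G) = (g.toLinearMap.comp i : E ⊗[𝕜] F →ₗ[𝕜] G) :=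
    TensorProduct.ext' h
  exact LinearMap.congr_fun e t

/-- The linear map on the algebraic tensor product induced by a bilinear map. -/
def algLift (B : E →L[𝕜] F →L[𝕜] G) : AlgTensor 𝕜 E F →ₗ[𝕜] G :=
  (TensorProduct.lift ((ContinuousLinearMap.coeLM 𝕜).comp B.toLinearMap) : E ⊗[𝕜] F →ₗ[𝕜] G)

theorem norm_algLift_le [IsUltrametricDist G] (B : E →L[𝕜] F →L[𝕜] G) (g : AlgTensor 𝕜 E F) :
    ‖algLift B g‖ ≤ ‖B‖ * ‖(UniformSpace.Completion.toComplL (𝕜 := 𝕜) g : CTensor 𝕜 E F)‖ := by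
  have key : ∀ c, g.IsBound c → ‖algLift B g‖ ≤ ‖B‖ * c := by
    rintro c ⟨hc, l, rfl, hl⟩
    induction l with
    | nil => simpa using by positivity
    | cons p l ih =>
      rw [List.map_cons, List.sum_cons, map_add]
      refine (IsUltrametricDist.norm_add_le_max _ _).trans (max_le ?_ ?_)
      · have h : algLift B (AlgTensor.tmul p.1 p.2) = B p.1 p.2 := TensorProduct.lift.tmul _ _
        rw [h]
        refine (B.le_opNorm₂ _ _).trans ?_
        rw [mul_assoc]
        exact mul_le_mul_of_nonneg_left (hl p (by simp)) (norm_nonneg B)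
      · exact ih fun q hq => hl q (by simp [hq])
  rw [UniformSpace.Completion.coe_toComplL, UniformSpace.Completion.norm_coe]
  rcases eq_or_lt_of_le (norm_nonneg B) with hB | hB
  · obtain ⟨d, hd⟩ := g.exists_isBound
    simpa [← hB] using key d hd
  · rw [← div_le_iff₀' hB]
    refine le_csInf g.exists_isBound fun d hd => ?_
    rw [div_le_iff₀' hB]
    exact key d hd

/-- The continuous linear map on the completed tensor product with `x ⊗ y ↦ B x y`. -/
def lift (B : E →L[𝕜] F →L[𝕜] G) [CompleteSpace G] [IsUltrametricDist G] :
    CTensor 𝕜 E F →L[𝕜] G :=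
  (algLift B).extendOfNorm (UniformSpace.Completion.toComplL (𝕜 := 𝕜)).toLinearMap

@[simp]
theorem lift_tmul [CompleteSpace G] [IsUltrametricDist G] (B : E →L[𝕜] F →L[𝕜] G) (x : E) (y : F) : lift B (tmul x y) = B x y :=
  (LinearMap.extendOfNorm_eq UniformSpace.Completion.denseRange_coe
    ⟨‖B‖, norm_algLift_le B⟩ (AlgTensor.tmul x y)).trans (TensorProduct.lift.tmul x y)

theorem norm_lift_le [CompleteSpace G] [IsUltrametricDist G] (B : E →L[𝕜] F →L[𝕜] G) : ‖lift B‖ ≤ ‖B‖ :=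
  LinearMap.opNorm_extendOfNorm_le UniformSpace.Completion.denseRange_coe (norm_nonneg B)
    (norm_algLift_le B)

/-- The tensor product `f ⊗ g` of continuous linear maps. -/
def mapT (f : E →L[𝕜] E') (g : F →L[𝕜] F') : CTensor 𝕜 E F →L[𝕜] CTensor 𝕜 E' F' :=
  lift (tmulL.bilinearComp f g)

@[simp]
theorem mapT_tmul (f : E →L[𝕜] E') (g : F →L[𝕜] F') (x : E) (y : F) :
    mapT f g (tmul x y) = tmul (f x) (g y) :=
  lift_tmul _ x y

theorem norm_mapT_le (f : E →L[𝕜] E') (g : F →L[𝕜] F') : ‖mapT f g‖ ≤ ‖f‖ * ‖g‖ := by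
  refine (norm_lift_le _).trans
    (ContinuousLinearMap.opNorm_le_bound₂ _ (by positivity) fun x y => ?_)
  refine (norm_tmul_le (f x) (g y)).trans ?_
  calc ‖f x‖ * ‖g y‖ ≤ (‖f‖ * ‖x‖) * (‖g‖ * ‖y‖) := by
        gcongr
        · exact f.le_opNorm x
        · exact g.le_opNorm y
    _ = ‖f‖ * ‖g‖ * ‖x‖ * ‖y‖ := by ring

/-- `(f, g) ↦ f ⊗ g` as a continuous bilinear map. -/
def mapTL : (E →L[𝕜] E') →L[𝕜] (F →L[𝕜] F') →L[𝕜] (CTensor 𝕜 E F →L[𝕜] CTensor 𝕜 E' F') :=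
  LinearMap.mkContinuous₂
    (LinearMap.mk₂ 𝕜 mapT
      (fun f f' g => CTensor.ext_clm fun x y => by simp [ContinuousLinearMap.map_add₂])
      (fun k f g => CTensor.ext_clm fun x y => by simp [ContinuousLinearMap.map_smul₂])
      (fun f g g' => CTensor.ext_clm fun x y => by simp)
      (fun k f g => CTensor.ext_clm fun x y => by simp))
    1 fun f g => by simpa using norm_mapT_le f g

@[simp]
theorem mapTL_apply (f : E →L[𝕜] E') (g : F →L[𝕜] F') : mapTL f g = mapT f g := rfl

/-- The associativity map `(E ⊗ F) ⊗ G → E ⊗ (F ⊗ G)`. -/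
def assocT (𝕜 E F G : Type*) [NontriviallyNormedField 𝕜]
    [NormedAddCommGroup E] [NormedSpace 𝕜 E] [NormedAddCommGroup F] [NormedSpace 𝕜 F]
    [NormedAddCommGroup G] [NormedSpace 𝕜 G] :
    CTensor 𝕜 (CTensor 𝕜 E F) G →L[𝕜] CTensor 𝕜 E (CTensor 𝕜 F G) :=
  lift ((mapTL (ContinuousLinearMap.id 𝕜 E)).comp tmulL.flip).flip

theorem assocT_tmul (x : E) (y : F) (z : G) :
    assocT 𝕜 E F G (tmul (tmul x y) z) = tmul x (tmul y z) := by
  simp [assocT]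

/-- The slice map `ω ⊗ id`. -/
def sliceLeft [CompleteSpace F] [IsUltrametricDist F] (ω : E →L[𝕜] 𝕜) : CTensor 𝕜 E F →L[𝕜] F :=
  lift ((ContinuousLinearMap.lsmul 𝕜 𝕜).comp ω)

/-- The slice map `id ⊗ ω`. -/
def sliceRight [CompleteSpace E] [IsUltrametricDist E] (ω : F →L[𝕜] 𝕜) : CTensor 𝕜 E F →L[𝕜] E :=
  lift ((ContinuousLinearMap.lsmul 𝕜 𝕜).comp ω).flip

theorem sliceLeft_tmul [CompleteSpace F] [IsUltrametricDist F] (ω : E →L[𝕜] 𝕜) (x : E) (y : F) :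
    sliceLeft ω (tmul x y) = ω x • y := by
  simp [sliceLeft]

theorem sliceRight_tmul [CompleteSpace E] [IsUltrametricDist E] (ω : F →L[𝕜] 𝕜) (x : E) (y : F) :
    sliceRight ω (tmul x y) = ω y • x := by
  simp [sliceRight]

end Lift

/-! ### The algebra structure on the completed tensor product -/

section Algebra

variable {𝕜 A B : Type*} [NontriviallyNormedField 𝕜]
  [NonUnitalNormedRing A] [NormedSpace 𝕜 A] [SMulCommClass 𝕜 A A] [IsScalarTower 𝕜 A A]
  [NonUnitalNormedRing B] [NormedSpace 𝕜 B] [SMulCommClass 𝕜 B B] [IsScalarTower 𝕜 B B]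

/-- The multiplication of `A ⊗ B` as a bilinear map: `(a ⊗ b)(a' ⊗ b') = aa' ⊗ bb'`. -/
def mulT : CTensor 𝕜 A B →L[𝕜] CTensor 𝕜 A B →L[𝕜] CTensor 𝕜 A B :=
  lift (mapTL.bilinearComp (ContinuousLinearMap.mul 𝕜 A) (ContinuousLinearMap.mul 𝕜 B))

@[simp]
theorem mulT_tmul (a a' : A) (b b' : B) :
    mulT (tmul a b) (tmul a' b') = (tmul (a * a') (b * b') : CTensor 𝕜 A B) := by
  simp [mulT]

theorem norm_mulT_le : ‖(mulT : CTensor 𝕜 A B →L[𝕜] _)‖ ≤ 1 := by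
  refine (norm_lift_le _).trans
    (ContinuousLinearMap.opNorm_le_bound₂ _ zero_le_one fun x y => ?_)
  refine (norm_mapT_le _ _).trans ?_
  rw [one_mul]
  exact mul_le_mul (ContinuousLinearMap.opNorm_mul_apply_le 𝕜 A x)
    (ContinuousLinearMap.opNorm_mul_apply_le 𝕜 B y) (norm_nonneg _) (norm_nonneg _)

theorem mulT_assoc (x y z : CTensor 𝕜 A B) : mulT (mulT x y) z = mulT x (mulT y z) := by
  have h1 : (mulT.flip z).comp (mulT.flip y) = mulT.flip (mulT y z) :=
    CTensor.ext_clm fun a b => by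
      have h2 : (mulT.flip z).comp (mulT (tmul a b)) = (mulT (tmul a b)).comp (mulT.flip z) :=
        CTensor.ext_clm fun a' b' => by
          have h3 : mulT (mulT (tmul a b) (tmul a' b')) =
              (mulT (tmul a b)).comp (mulT (𝕜 := 𝕜) (tmul a' b')) :=
            CTensor.ext_clm fun a'' b'' => by simp [mul_assoc]
          exact DFunLike.congr_fun h3 z
      exact DFunLike.congr_fun h2 y
  exact DFunLike.congr_fun h1 x

instance : NonUnitalNormedRing (CTensor 𝕜 A B) where
  __ := (inferInstance : NormedAddCommGroup (CTensor 𝕜 A B))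
  mul x y := mulT x y
  left_distrib x y z := map_add (mulT x) y z
  right_distrib x y z := by
    change mulT (x + y) z = mulT x z + mulT y z
    rw [map_add, _root_.add_apply]
  zero_mul x := by
    change mulT 0 x = 0
    rw [map_zero, _root_.zero_apply]
  mul_zero x := map_zero (mulT x)
  mul_assoc := mulT_assoc
  norm_mul_le x y := by
    refine (ContinuousLinearMap.le_opNorm₂ mulT x y).trans ?_
    gcongr
    exact mul_le_of_le_one_left (norm_nonneg x) norm_mulT_le

theorem CTensor.mul_def (x y : CTensor 𝕜 A B) : x * y = mulT x y := rfl

@[simp]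
theorem tmul_mul_tmul (a a' : A) (b b' : B) :
    (tmul a b * tmul a' b' : CTensor 𝕜 A B) = tmul (a * a') (b * b') :=
  mulT_tmul a a' b b'

instance : SMulCommClass 𝕜 (CTensor 𝕜 A B) (CTensor 𝕜 A B) :=
  ⟨fun k x y => (map_smul (mulT x) k y).symm⟩

instance : IsScalarTower 𝕜 (CTensor 𝕜 A B) (CTensor 𝕜 A B) :=
  ⟨fun k x y => by
    change mulT (k • x) y = k • mulT x y
    rw [map_smul, _root_.smul_apply]⟩

end Algebra

/-! ### Multipliers

`𝓜(𝕜, A)` is the algebra of pairs `(fst, snd)` of bounded operators with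
`snd a * b = a * fst b`; for a multiplier `m` one has `m a = m.fst a` and `a m = m.snd a`. -/

section Multiplier

variable {𝕜 A B : Type*} [NontriviallyNormedField 𝕜]
  [NonUnitalNormedRing A] [NormedSpace 𝕜 A] [SMulCommClass 𝕜 A A] [IsScalarTower 𝕜 A A]
  [NonUnitalNormedRing B] [NormedSpace 𝕜 B] [SMulCommClass 𝕜 B B] [IsScalarTower 𝕜 B B]

theorem multiplier_norm (m : 𝓜(𝕜, A)) : ‖m‖ = max ‖m.fst‖ ‖m.snd‖ := rfl

instance multiplier_isUltrametricDist [IsUltrametricDist A] : IsUltrametricDist 𝓜(𝕜, A) :=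
  IsUltrametricDist.isUltrametricDist_of_forall_norm_add_le_max_norm fun x y => by
    simp only [multiplier_norm, DoubleCentralizer.add_fst, DoubleCentralizer.add_snd]
    have h1 := IsUltrametricDist.norm_add_le_max x.fst y.fst
    have h2 := IsUltrametricDist.norm_add_le_max x.snd y.snd
    refine max_le (h1.trans ?_) (h2.trans ?_)
    · exact max_le_max (le_max_left _ _) (le_max_left _ _)
    · exact max_le_max (le_max_right _ _) (le_max_right _ _)

/-- The canonical map `A → M(A)`. -/
def toM : A →L[𝕜] 𝓜(𝕜, A) :=
  LinearMap.mkContinuous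
    { toFun := DoubleCentralizer.coe 𝕜
      map_add' := fun x y => DoubleCentralizer.ext _ _ _ _ <|
        Prod.ext (map_add (ContinuousLinearMap.mul 𝕜 A) x y)
          (map_add (ContinuousLinearMap.mul 𝕜 A).flip x y)
      map_smul' := fun k x => DoubleCentralizer.ext _ _ _ _ <|
        Prod.ext (map_smul (ContinuousLinearMap.mul 𝕜 A) k x)
          (map_smul (ContinuousLinearMap.mul 𝕜 A).flip k x) }
    1 fun x => by
      rw [one_mul, multiplier_norm]
      exact max_le (ContinuousLinearMap.opNorm_mul_apply_le 𝕜 A x)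
        (ContinuousLinearMap.opNorm_le_bound _ (norm_nonneg x) fun y =>
          (norm_mul_le y x).trans_eq (mul_comm _ _))

@[simp]
theorem toM_fst (a b : A) : (toM a : 𝓜(𝕜, A)).fst b = a * b := rfl

@[simp]
theorem toM_snd (a b : A) : (toM a : 𝓜(𝕜, A)).snd b = b * a := rfl

/-- The multiplier `m ⊗ n` of `A ⊗ B`. -/
def tensorM (m : 𝓜(𝕜, A)) (n : 𝓜(𝕜, B)) : 𝓜(𝕜, CTensor 𝕜 A B) where
  fst := mapT m.fst n.fst
  snd := mapT m.snd n.snd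
  central x y := by
    change mulT (mapT m.snd n.snd x) y = mulT x (mapT m.fst n.fst y)
    have h1 : (mulT.flip y).comp (mapT m.snd n.snd) = mulT.flip (mapT m.fst n.fst y) :=
      CTensor.ext_clm fun a b => by
        have h2 : mulT (mapT m.snd n.snd (tmul a b)) =
            (mulT (tmul a b)).comp (mapT m.fst n.fst) :=
          CTensor.ext_clm fun a' b' => by simp [m.central, n.central]
        exact DFunLike.congr_fun h2 y
    exact DFunLike.congr_fun h1 x

@[simp]
theorem tensorM_fst (m : 𝓜(𝕜, A)) (n : 𝓜(𝕜, B)) : (tensorM m n).fst = mapT m.fst n.fst := rfl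

@[simp]
theorem tensorM_snd (m : 𝓜(𝕜, A)) (n : 𝓜(𝕜, B)) : (tensorM m n).snd = mapT m.snd n.snd := rfl

theorem norm_tensorM_le (m : 𝓜(𝕜, A)) (n : 𝓜(𝕜, B)) : ‖tensorM m n‖ ≤ ‖m‖ * ‖n‖ := by
  rw [multiplier_norm]
  refine max_le ((norm_mapT_le _ _).trans ?_) ((norm_mapT_le _ _).trans ?_)
  · exact mul_le_mul (le_max_left _ _) (le_max_left _ _) (norm_nonneg _) (norm_nonneg _)
  · exact mul_le_mul (le_max_right _ _) (le_max_right _ _) (norm_nonneg _) (norm_nonneg _)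

/-- `(m, n) ↦ m ⊗ n` as a bilinear map. -/
def tensorMLin : 𝓜(𝕜, A) →ₗ[𝕜] 𝓜(𝕜, B) →ₗ[𝕜] 𝓜(𝕜, CTensor 𝕜 A B) :=
  LinearMap.mk₂ 𝕜 tensorM
    (fun m m' n => DoubleCentralizer.ext _ _ _ _ <|
      Prod.ext (by simp [← mapTL_apply]) (by simp [← mapTL_apply]))
    (fun k m n => DoubleCentralizer.ext _ _ _ _ <|
      Prod.ext (by simp [← mapTL_apply]) (by simp [← mapTL_apply]))
    (fun m n n' => DoubleCentralizer.ext _ _ _ _ <|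
      Prod.ext (by simp [← mapTL_apply]) (by simp [← mapTL_apply]))
    (fun k m n => DoubleCentralizer.ext _ _ _ _ <|
      Prod.ext (by simp [← mapTL_apply]) (by simp [← mapTL_apply]))

theorem norm_tensorMLin_le (m : 𝓜(𝕜, A)) (n : 𝓜(𝕜, B)) :
    ‖tensorMLin m n‖ ≤ 1 * ‖m‖ * ‖n‖ := by
  rw [one_mul]
  exact norm_tensorM_le m n

/-- `(m, n) ↦ m ⊗ n` as a continuous bilinear map. -/
def tensorML : 𝓜(𝕜, A) →L[𝕜] 𝓜(𝕜, B) →L[𝕜] 𝓜(𝕜, CTensor 𝕜 A B) :=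
  LinearMap.mkContinuous₂ tensorMLin 1 norm_tensorMLin_le

@[simp]
theorem tensorML_apply (m : 𝓜(𝕜, A)) (n : 𝓜(𝕜, B)) : tensorML m n = tensorM m n := rfl

end Multiplier

/-! ### Nondegenerate homomorphisms and their extension to multipliers -/

section Extension

variable {𝕜 A B : Type*} [NontriviallyNormedField 𝕜]
  [NonUnitalNormedRing A] [NormedSpace 𝕜 A] [SMulCommClass 𝕜 A A] [IsScalarTower 𝕜 A A]
  [NonUnitalNormedRing B] [NormedSpace 𝕜 B] [SMulCommClass 𝕜 B B] [IsScalarTower 𝕜 B B]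

/-- The product of `A` is nondegenerate. -/
def NondegenerateProduct (A : Type*) [NonUnitalNormedRing A] : Prop :=
  (∀ a : A, (∀ b, a * b = 0) → a = 0) ∧ ∀ b : A, (∀ a, a * b = 0) → b = 0

/-- `A` has a bounded approximate identity (with nets written as filters). -/
def HasBoundedApproximateIdentity (A : Type*) [NonUnitalNormedRing A] : Prop :=
  ∃ l : Filter A, l.IsApproximateUnit ∧ ∃ C : ℝ, ∀ᶠ e in l, ‖e‖ ≤ C

/-- The underlying normed space is polar. -/
def IsPolar (𝕜 E : Type*) [NontriviallyNormedField 𝕜] [NormedAddCommGroup E] [NormedSpace 𝕜 E] :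
    Prop :=
  ∀ y : E, 1 < ‖y‖ → ∃ f : E →L[𝕜] 𝕜, (∀ x, ‖x‖ ≤ 1 → ‖f x‖ ≤ 1) ∧ 1 < ‖f y‖

/-- The spans of `{Φ(a)b}` and of `{bΦ(a)}` are dense in `B`. -/
def IsNondegenerateHom (Φ : A →L[𝕜] 𝓜(𝕜, B)) : Prop :=
  Dense (Submodule.span 𝕜 (Set.range fun p : A × B => (Φ p.1).fst p.2) : Set B) ∧
  Dense (Submodule.span 𝕜 (Set.range fun p : A × B => (Φ p.1).snd p.2) : Set B)

/-- `n` is the value at `m` of the extension of the homomorphism `Φ` to multipliers: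
`n (Φ(a) b) = Φ(m a) b` and `(b Φ(a)) n = b Φ(a m)`. -/
def IsExtensionAt (Φ : A →L[𝕜] 𝓜(𝕜, B)) (m : 𝓜(𝕜, A)) (n : 𝓜(𝕜, B)) : Prop :=
  ∀ a b, n.fst ((Φ a).fst b) = (Φ (m.fst a)).fst b ∧ n.snd ((Φ a).snd b) = (Φ (m.snd a)).snd b

/-- `n` is the value at `m` of the extension of the anti-homomorphism `Φ` to multipliers:
`n (Φ(a) b) = Φ(a m) b` and `(b Φ(a)) n = b Φ(m a)`. -/
def IsAntiExtensionAt (Φ : A →L[𝕜] 𝓜(𝕜, B)) (m : 𝓜(𝕜, A)) (n : 𝓜(𝕜, B)) : Prop :=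
  ∀ a b, n.fst ((Φ a).fst b) = (Φ (m.snd a)).fst b ∧ n.snd ((Φ a).snd b) = (Φ (m.fst a)).snd b

open Classical in
/-- The extension `M(A) → M(B)` of a nondegenerate homomorphism `Φ : A → M(B)`; see
`existsUnique_isExtensionAt` for its well-definedness. -/
def extendM (Φ : A →L[𝕜] 𝓜(𝕜, B)) (m : 𝓜(𝕜, A)) : 𝓜(𝕜, B) :=
  if h : ∃ n, IsExtensionAt Φ m n then h.choose else 0

open Classical in
/-- The extension `M(A) → M(B)` of a nondegenerate anti-homomorphism `Φ : A → M(B)`; see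
`existsUnique_isAntiExtensionAt` for its well-definedness. -/
def antiExtendM (Φ : A →L[𝕜] 𝓜(𝕜, B)) (m : 𝓜(𝕜, A)) : 𝓜(𝕜, B) :=
  if h : ∃ n, IsAntiExtensionAt Φ m n then h.choose else 0

theorem exists_clm_of_tendsto {E ι I : Type*} [NormedAddCommGroup E] [NormedSpace 𝕜 E]
    [CompleteSpace E] (l : Filter I) [l.NeBot] (T : I → E →L[𝕜] E) (C : ℝ)
    (hC : ∀ᶠ i in l, ‖T i‖ ≤ C) (u v : ι → E)
    (hu : Dense (Submodule.span 𝕜 (Set.range u) : Set E))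
    (h : ∀ p, Filter.Tendsto (fun i => T i (u p)) l (nhds (v p))) :
    ∃ L : E →L[𝕜] E, ∀ p, L (u p) = v p := by
  have hd : DenseRange (Finsupp.linearCombination 𝕜 u) := by
    rwa [DenseRange, ← LinearMap.coe_range, Finsupp.range_linearCombination]
  have hlim : ∀ x : ι →₀ 𝕜, Filter.Tendsto (fun i => T i (Finsupp.linearCombination 𝕜 u x)) l
      (nhds (Finsupp.linearCombination 𝕜 v x)) := fun x => by
    simp only [Finsupp.linearCombination_apply, Finsupp.sum, map_sum, map_smul]
    exact tendsto_finsetSum _ fun p _ => (h p).const_smul _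
  have hb : ∀ x : ι →₀ 𝕜, ‖Finsupp.linearCombination 𝕜 v x‖ ≤
      C * ‖Finsupp.linearCombination 𝕜 u x‖ := fun x =>
    le_of_tendsto (hlim x).norm (hC.mono fun i hi => (T i).le_of_opNorm_le hi _)
  refine ⟨(Finsupp.linearCombination 𝕜 v).extendOfNorm (Finsupp.linearCombination 𝕜 u), fun p => ?_⟩
  have := LinearMap.extendOfNorm_eq hd ⟨C, hb⟩ (Finsupp.single p 1)
  simpa using this

theorem existsUnique_multiplier [CompleteSpace B] (hA : HasBoundedApproximateIdentity A)
    (Φ : A →L[𝕜] 𝓜(𝕜, B)) (hΦ : IsNondegenerateHom Φ) (p q : A →L[𝕜] A)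
    (hpq : ∀ a a', Φ (q a) * Φ a' = Φ a * Φ (p a'))
    (hp : (∀ e a, Φ (p e) * Φ a = Φ (p (e * a))) ∨ ∀ e a, Φ (p e) * Φ a = Φ (p (a * e)))
    (hq : (∀ e a, Φ a * Φ (q e) = Φ (q (e * a))) ∨ ∀ e a, Φ a * Φ (q e) = Φ (q (a * e))) :
    ∃! n : 𝓜(𝕜, B), ∀ a b, n.fst ((Φ a).fst b) = (Φ (p a)).fst b ∧
      n.snd ((Φ a).snd b) = (Φ (q a)).snd b := by
  obtain ⟨l, hl, C, hC⟩ := hA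
  have := hl.neBot
  have hbd : ∀ r : A →L[𝕜] A, ∀ᶠ e in l, ‖Φ (r e)‖ ≤ ‖Φ‖ * (‖r‖ * C) := fun r =>
    hC.mono fun e he => Φ.le_opNorm_of_le (r.le_opNorm_of_le he)
  have hfst : ∀ b, Continuous fun n : 𝓜(𝕜, B) => n.fst b := fun b =>
    AddMonoidHomClass.continuous_of_bound
      (AddMonoidHom.mk' (fun n : 𝓜(𝕜, B) => n.fst b) fun _ _ => rfl) ‖b‖ fun n => by
      rw [mul_comm]
      exact (n.fst.le_opNorm b).trans (by gcongr; exact le_max_left _ _)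
  have hsnd : ∀ b, Continuous fun n : 𝓜(𝕜, B) => n.snd b := fun b =>
    AddMonoidHomClass.continuous_of_bound
      (AddMonoidHom.mk' (fun n : 𝓜(𝕜, B) => n.snd b) fun _ _ => rfl) ‖b‖ fun n => by
      rw [mul_comm]
      exact (n.snd.le_opNorm b).trans (by gcongr; exact le_max_right _ _)
  obtain ⟨L, hL⟩ := exists_clm_of_tendsto l (fun e => (Φ (p e)).fst) (‖Φ‖ * (‖p‖ * C))
    ((hbd p).mono fun e he => (le_max_left _ _).trans he)
    (fun x : A × B => (Φ x.1).fst x.2) (fun x : A × B => (Φ (p x.1)).fst x.2) hΦ.1 (by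
      rintro ⟨a, b⟩
      have key : Filter.Tendsto (fun e => Φ (p e) * Φ a) l (nhds (Φ (p a))) := by
        rcases hp with hp | hp <;> simp only [hp]
        · exact ((Φ.comp p).continuous.tendsto a).comp (hl.tendsto_mul_right a)
        · exact ((Φ.comp p).continuous.tendsto a).comp (hl.tendsto_mul_left a)
      exact ((hfst b).tendsto _).comp key)
  obtain ⟨R, hR⟩ := exists_clm_of_tendsto l (fun e => (Φ (q e)).snd) (‖Φ‖ * (‖q‖ * C))
    ((hbd q).mono fun e he => (le_max_right _ _).trans he)
    (fun x : A × B => (Φ x.1).snd x.2) (fun x : A × B => (Φ (q x.1)).snd x.2) hΦ.2 (by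
      rintro ⟨a, b⟩
      have key : Filter.Tendsto (fun e => Φ a * Φ (q e)) l (nhds (Φ (q a))) := by
        rcases hq with hq | hq <;> simp only [hq]
        · exact ((Φ.comp q).continuous.tendsto a).comp (hl.tendsto_mul_right a)
        · exact ((Φ.comp q).continuous.tendsto a).comp (hl.tendsto_mul_left a)
      exact ((hsnd b).tendsto _).comp key)
  refine ⟨⟨(L, R), fun x y => ?_⟩, fun a b => ⟨hL (a, b), hR (a, b)⟩, fun n hn => ?_⟩
  · change R x * y = x * L y
    have h1 : ((ContinuousLinearMap.mul 𝕜 B).flip y).comp R =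
        (ContinuousLinearMap.mul 𝕜 B).flip (L y) := by
      refine ContinuousLinearMap.ext_on hΦ.2 ?_
      rintro _ ⟨⟨a, b⟩, rfl⟩
      have h2 : ContinuousLinearMap.mul 𝕜 B (R ((Φ a).snd b)) =
          (ContinuousLinearMap.mul 𝕜 B ((Φ a).snd b)).comp L := by
        refine ContinuousLinearMap.ext_on hΦ.1 ?_
        rintro _ ⟨⟨a', b'⟩, rfl⟩
        have h3 := DFunLike.congr_fun (congrArg (fun n : 𝓜(𝕜, B) => n.fst) (hpq a a')) b'
        have h4 := hL (a', b')
        have h5 := hR (a, b)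
        simp only at h4 h5
        simp only [ContinuousLinearMap.mul_apply', ContinuousLinearMap.comp_apply, h4, h5,
          DoubleCentralizer.central]
        exact congrArg (b * ·) h3
      exact DFunLike.congr_fun h2 y
    exact DFunLike.congr_fun h1 x
  · refine DoubleCentralizer.ext _ _ _ _ (Prod.ext ?_ ?_)
    · refine ContinuousLinearMap.ext_on hΦ.1 ?_
      rintro _ ⟨⟨a, b⟩, rfl⟩
      exact ((hn a b).1).trans (hL (a, b)).symm
    · refine ContinuousLinearMap.ext_on hΦ.2 ?_
      rintro _ ⟨⟨a, b⟩, rfl⟩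
      exact ((hn a b).2).trans (hR (a, b)).symm

theorem fst_mul (hA : NondegenerateProduct A) (m : 𝓜(𝕜, A)) (a b : A) :
    m.fst (a * b) = m.fst a * b := by
  rw [← sub_eq_zero]
  refine hA.2 _ fun c => ?_
  rw [mul_sub, ← m.central, ← mul_assoc, ← mul_assoc, ← m.central, sub_self]

theorem snd_mul (hA : NondegenerateProduct A) (m : 𝓜(𝕜, A)) (a b : A) :
    m.snd (a * b) = a * m.snd b := by
  rw [← sub_eq_zero]
  refine hA.1 _ fun c => ?_
  rw [sub_mul, m.central, mul_assoc, mul_assoc, m.central, sub_self]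

/-- The extension of a nondegenerate homomorphism to multipliers exists and is unique. -/
theorem existsUnique_isExtensionAt [CompleteSpace B] (hA : HasBoundedApproximateIdentity A)
    (hA' : NondegenerateProduct A) (Φ : A →L[𝕜] 𝓜(𝕜, B)) (hmul : ∀ a b, Φ (a * b) = Φ a * Φ b)
    (hΦ : IsNondegenerateHom Φ) (m : 𝓜(𝕜, A)) : ∃! n, IsExtensionAt Φ m n :=
  existsUnique_multiplier hA Φ hΦ m.fst m.snd
    (fun a a' => by rw [← hmul, ← hmul, m.central])
    (Or.inl fun e a => by rw [← hmul, fst_mul hA'])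
    (Or.inr fun e a => by rw [← hmul, snd_mul hA'])

/-- The extension of a nondegenerate anti-homomorphism to multipliers exists and is unique. -/
theorem existsUnique_isAntiExtensionAt [CompleteSpace B] (hA : HasBoundedApproximateIdentity A)
    (hA' : NondegenerateProduct A) (Φ : A →L[𝕜] 𝓜(𝕜, B)) (hmul : ∀ a b, Φ (a * b) = Φ b * Φ a)
    (hΦ : IsNondegenerateHom Φ) (m : 𝓜(𝕜, A)) : ∃! n, IsAntiExtensionAt Φ m n :=
  existsUnique_multiplier hA Φ hΦ m.snd m.fst
    (fun a a' => by rw [← hmul, ← hmul, m.central])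
    (Or.inr fun e a => by rw [← hmul, snd_mul hA'])
    (Or.inl fun e a => by rw [← hmul, fst_mul hA'])

end Extension

/-! ### Regular multiplier Banach-Hopf algebras -/

section Hopf

variable {𝕜 A : Type*} [NontriviallyNormedField 𝕜]
  [NonUnitalNormedRing A] [NormedSpace 𝕜 A] [SMulCommClass 𝕜 A A] [IsScalarTower 𝕜 A A]

/-- `Δ ⊗ id : A ⊗ A → M((A ⊗ A) ⊗ A)`. -/
def comulTensorId (Δ : A →L[𝕜] 𝓜(𝕜, CTensor 𝕜 A A)) :
    CTensor 𝕜 A A →L[𝕜] 𝓜(𝕜, CTensor 𝕜 (CTensor 𝕜 A A) A) :=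
  lift (tensorML.bilinearComp Δ toM)

/-- `id ⊗ Δ : A ⊗ A → M(A ⊗ (A ⊗ A))`. -/
def idTensorComul (Δ : A →L[𝕜] 𝓜(𝕜, CTensor 𝕜 A A)) :
    CTensor 𝕜 A A →L[𝕜] 𝓜(𝕜, CTensor 𝕜 A (CTensor 𝕜 A A)) :=
  lift (tensorML.bilinearComp toM Δ)

/-- Coassociativity `(Δ ⊗ id)Δ = (id ⊗ Δ)Δ`, with `Δ ⊗ id` and `id ⊗ Δ` extended to `M(A ⊗ A)`
and with `(A ⊗ A) ⊗ A` and `A ⊗ (A ⊗ A)` identified by the associativity map. -/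
def IsCoassociative (Δ : A →L[𝕜] 𝓜(𝕜, CTensor 𝕜 A A)) : Prop :=
  ∀ a z,
    assocT 𝕜 A A A ((extendM (comulTensorId Δ) (Δ a)).fst z) =
      (extendM (idTensorComul Δ) (Δ a)).fst (assocT 𝕜 A A A z) ∧
    assocT 𝕜 A A A ((extendM (comulTensorId Δ) (Δ a)).snd z) =
      (extendM (idTensorComul Δ) (Δ a)).snd (assocT 𝕜 A A A z)

variable (𝕜 A) in
/-- The structure of a (regular) multiplier Banach-Hopf algebra: a comultiplication `Δ` for which
the four maps `T₁, …, T₄` take values in `A ⊗ A` and extend to bijective linear isometries. -/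
structure MultiplierBanachHopf where
  /-- The comultiplication. -/
  Δ : A →L[𝕜] 𝓜(𝕜, CTensor 𝕜 A A)
  map_mul : ∀ a b, Δ (a * b) = Δ a * Δ b
  nondegenerate : IsNondegenerateHom Δ
  coassoc : IsCoassociative Δ
  /-- `T₁(a ⊗ b) = Δ(a)(1 ⊗ b)`. -/
  T₁ : CTensor 𝕜 A A ≃ₗᵢ[𝕜] CTensor 𝕜 A A
  T₁_spec : ∀ a b, toM (T₁ (tmul a b)) = Δ a * tensorM 1 (toM b)
  /-- `T₂(a ⊗ b) = (a ⊗ 1)Δ(b)`. -/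
  T₂ : CTensor 𝕜 A A ≃ₗᵢ[𝕜] CTensor 𝕜 A A
  T₂_spec : ∀ a b, toM (T₂ (tmul a b)) = tensorM (toM a) 1 * Δ b
  /-- `T₃(a ⊗ b) = (1 ⊗ b)Δ(a)`. -/
  T₃ : CTensor 𝕜 A A ≃ₗᵢ[𝕜] CTensor 𝕜 A A
  T₃_spec : ∀ a b, toM (T₃ (tmul a b)) = tensorM 1 (toM b) * Δ a
  /-- `T₄(a ⊗ b) = Δ(b)(a ⊗ 1)`. -/
  T₄ : CTensor 𝕜 A A ≃ₗᵢ[𝕜] CTensor 𝕜 A A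
  T₄_spec : ∀ a b, toM (T₄ (tmul a b)) = Δ b * tensorM (toM a) 1

variable [IsUltrametricDist A] [CompleteSpace A]

/-- The multiplication map `m : A ⊗ A → A`, `m(a ⊗ b) = ab`. -/
def mulMap : CTensor 𝕜 A A →L[𝕜] A := lift (ContinuousLinearMap.mul 𝕜 A)

namespace MultiplierBanachHopf

variable (H : MultiplierBanachHopf 𝕜 A)

open Classical in
/-- The counit, determined by `ε(a) b = m T₁⁻¹(a ⊗ b)`. -/
def counit : A →L[𝕜] 𝕜 :=
  if h : ∃ ε : A →L[𝕜] 𝕜, ∀ a b, ε a • b = mulMap (H.T₁.symm (tmul a b)) then h.choose else 0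

open Classical in
/-- The antipode, determined by `S(a) b = (ε ⊗ id) T₁⁻¹(a ⊗ b)`. -/
def antipode : A →L[𝕜] A :=
  if h : ∃ S : A →L[𝕜] A, ∀ a b, S a * b = sliceLeft H.counit (H.T₁.symm (tmul a b))
  then h.choose else 0

/-- `m = (ω ⊗ id)Δ(a)` as multipliers of `A`: `m b = (ω ⊗ id)(Δ(a)(1 ⊗ b))` and
`b m = (ω ⊗ id)((1 ⊗ b)Δ(a))`. -/
def IsLeftSlice (ω : A →L[𝕜] 𝕜) (a : A) (m : 𝓜(𝕜, A)) : Prop :=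
  ∀ b, m.fst b = sliceLeft ω (H.T₁ (tmul a b)) ∧ m.snd b = sliceLeft ω (H.T₃ (tmul a b))

/-- `m = (id ⊗ ω)Δ(a)` as multipliers of `A`: `m b = (id ⊗ ω)(Δ(a)(b ⊗ 1))` and
`b m = (id ⊗ ω)((b ⊗ 1)Δ(a))`. -/
def IsRightSlice (ω : A →L[𝕜] 𝕜) (a : A) (m : 𝓜(𝕜, A)) : Prop :=
  ∀ b, m.fst b = sliceRight ω (H.T₄ (tmul b a)) ∧ m.snd b = sliceRight ω (H.T₂ (tmul b a))

/-- `φ` is a (nonzero, continuous) left-invariant functional: `(id ⊗ φ)Δ(a) = φ(a) 1`. -/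
def IsLeftInvariant (φ : A →L[𝕜] 𝕜) : Prop :=
  φ ≠ 0 ∧ ∀ a, H.IsRightSlice φ a (φ a • 1)

/-- The extension of the comultiplication to `M(A) → M(A ⊗ A)`. -/
def comulM (m : 𝓜(𝕜, A)) : 𝓜(𝕜, CTensor 𝕜 A A) := extendM H.Δ m

/-- The extension of the counit to `M(A) → M(𝕜) = 𝕜`. -/
def counitM (m : 𝓜(𝕜, A)) : 𝕜 := (extendM (toM.comp H.counit) m).fst 1

/-- The extension of the antipode to `M(A) → M(A)`. -/
def antipodeM (m : 𝓜(𝕜, A)) : 𝓜(𝕜, A) := antiExtendM (toM.comp H.antipode) m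

end MultiplierBanachHopf

end Hopf

end NABanach

end

open scoped TensorProduct MultiplierAlgebra

noncomputable section

namespace NABanach

/-! ### Density and extensionality in completed tensor products -/

section TensorInduction

variable {𝕜 E F G E' F' E'' F'' : Type*} [NontriviallyNormedField 𝕜]
  [NormedAddCommGroup E] [NormedSpace 𝕜 E] [NormedAddCommGroup F] [NormedSpace 𝕜 F]
  [NormedAddCommGroup E'] [NormedSpace 𝕜 E'] [NormedAddCommGroup F'] [NormedSpace 𝕜 F']
  [NormedAddCommGroup E''] [NormedSpace 𝕜 E''] [NormedAddCommGroup F''] [NormedSpace 𝕜 F'']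
  [NormedAddCommGroup G] [NormedSpace 𝕜 G]

/-! The core is strong left invariance, S((id ⊗ φ)(Δ(a)(1 ⊗ b))) = (id ⊗ φ)((1 ⊗ a)Δ(b))
(`antipode_sliceRight`). Applying id ⊗ id ⊗ φ to the coassociativity identity `pentagon` computes
T₁⁻¹ on (id ⊗ φ)(Δ(a)(1 ⊗ b)) ⊗ c; this yields the identity, and also that S exists and is onto. It
follows that ψ = φ ∘ S is right invariant (`sliceLeft_comp_antipode_T₁`), and evaluating (φ ⊗ φ)((1
⊗ a)Δ(b)) in two ways gives φ((φ ⊗ id)((1 ⊗ a)Δ(b))) = φ(S(a)) φ(b) (`apply_sliceLeft_T₃`).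

The right side depends on b only through φ(b). Once φ is known to be faithful, this forces (φ ⊗
id)Δ(b) = φ(b)δ with δ = (φ ⊗ id)Δ(e), where φ(e) = 1 (`exists_modular`), and b = e gives φ(S(a)) =
φ(aδ).

Faithfulness is the delicate point. If φ(ay) = 0 for all a, strong invariance gives (id ⊗ φ(a
·))(Δ(y)(c ⊗ 1)) = 0 for all a and c. Replacing the constant a by S of the first leg turns this into
φ(m(S ⊗ id)(Δ(y)(c ⊗ 1))) = ε(y)φ(S(c)) = 0. In a completed tensor product this replacement needs an
argument: `lift_comp_eq_zero` provides it through nearly orthogonal expansions and the ultrametric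
inequality. Hence ε(y) = 0. The slices (f ⊗ id)(Δ(y)(c ⊗ 1)) inherit the assumption on y and have
counit f(yc), so polarity gives y = 0 (`faithful`).

Finally, bijectivity of T₁ and T₃ inverts δ, applying φ ⊗ id ⊗ id to `pentagon` gives Δ(δ) = δ ⊗ δ,
and the values of ε and S at δ follow from how δ commutes with T₁. -/

theorem CTensor.congr_clm (f g : CTensor 𝕜 E F →L[𝕜] G) (h : ∀ x y, f (tmul x y) = g (tmul x y))
    (z : CTensor 𝕜 E F) : f z = g z :=
  DFunLike.congr_fun (CTensor.ext_clm h) z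

theorem CTensor.mem_of_forall_tmul (W : Submodule 𝕜 (CTensor 𝕜 E F))
    (hW : IsClosed (W : Set (CTensor 𝕜 E F))) (h : ∀ x y, tmul x y ∈ W) (z : CTensor 𝕜 E F) :
    z ∈ W := by
  refine UniformSpace.Completion.induction_on z hW fun t => ?_
  refine TensorProduct.induction_on
    (motive := fun t => UniformSpace.Completion.toComplL (𝕜 := 𝕜) (E := AlgTensor 𝕜 E F) t ∈ W)
    t ?_ h ?_
  · exact (map_zero (UniformSpace.Completion.toComplL (𝕜 := 𝕜) (E := AlgTensor 𝕜 E F))).symm ▸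
      W.zero_mem
  · intro x y hx hy
    exact (map_add (UniformSpace.Completion.toComplL (𝕜 := 𝕜) (E := AlgTensor 𝕜 E F)) x y).symm ▸
      W.add_mem hx hy

/-- Density is passed through one leg at a time. This makes a tensor product of nondegenerate
homomorphisms nondegenerate. -/
theorem CTensor.dense_span_tmul {ι κ : Type*} {u : ι → E} {v : κ → F}
    (hu : Dense (Submodule.span 𝕜 (Set.range u) : Set E))
    (hv : Dense (Submodule.span 𝕜 (Set.range v) : Set F)) :
    Dense (Submodule.span 𝕜 (Set.range fun p : ι × κ => (tmul (u p.1) (v p.2) : CTensor 𝕜 E F)) :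
      Set (CTensor 𝕜 E F)) := by
  set W := (Submodule.span 𝕜
    (Set.range fun p : ι × κ => (tmul (u p.1) (v p.2) : CTensor 𝕜 E F))).topologicalClosure
  have hW : IsClosed (W : Set (CTensor 𝕜 E F)) := Submodule.isClosed_topologicalClosure _
  have h1 : ∀ i y, (tmul (u i) y : CTensor 𝕜 E F) ∈ W := fun i y => by
    have hc : IsClosed {y : F | (tmul (u i) y : CTensor 𝕜 E F) ∈ W} :=
      hW.preimage (tmulL (u i)).continuous
    have hs : (Submodule.span 𝕜 (Set.range v) : Set F) ⊆
        {y : F | (tmul (u i) y : CTensor 𝕜 E F) ∈ W} := by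
      change Submodule.span 𝕜 (Set.range v) ≤ W.comap (tmulL (u i)).toLinearMap
      rw [Submodule.span_le]
      rintro _ ⟨j, rfl⟩
      exact Submodule.le_topologicalClosure _ (Submodule.subset_span ⟨(i, j), rfl⟩)
    exact hc.closure_subset_iff.2 hs (hv y)
  have h2 : ∀ x y, (tmul x y : CTensor 𝕜 E F) ∈ W := fun x y => by
    have hc : IsClosed {x : E | (tmul x y : CTensor 𝕜 E F) ∈ W} :=
      hW.preimage ((tmulL (𝕜 := 𝕜) (E := E) (F := F)).flip y).continuous
    have hs : (Submodule.span 𝕜 (Set.range u) : Set E) ⊆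
        {x : E | (tmul x y : CTensor 𝕜 E F) ∈ W} := by
      change Submodule.span 𝕜 (Set.range u) ≤ W.comap ((tmulL (𝕜 := 𝕜) (E := E) (F := F)).flip y).toLinearMap
      rw [Submodule.span_le]
      rintro _ ⟨i, rfl⟩
      exact h1 i y
    exact hc.closure_subset_iff.2 hs (hu x)
  exact fun z => CTensor.mem_of_forall_tmul W hW h2 z

theorem mapT_id_id (z : CTensor 𝕜 E F) :
    mapT (ContinuousLinearMap.id 𝕜 E) (ContinuousLinearMap.id 𝕜 F) z = z :=
  CTensor.congr_clm (mapT (.id 𝕜 E) (.id 𝕜 F)) (.id 𝕜 _) (fun x y => by simp) z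

theorem mapT_mapT (f : E →L[𝕜] E') (g : F →L[𝕜] F') (f' : E' →L[𝕜] E'') (g' : F' →L[𝕜] F'')
    (z : CTensor 𝕜 E F) : mapT f' g' (mapT f g z) = mapT (f'.comp f) (g'.comp g) z :=
  CTensor.congr_clm ((mapT f' g').comp (mapT f g)) (mapT (f'.comp f) (g'.comp g))
    (fun x y => by simp) z

theorem mapT_comp (f : E →L[𝕜] E') (g : F →L[𝕜] F') (f' : E' →L[𝕜] E'') (g' : F' →L[𝕜] F'') :
    (mapT f' g').comp (mapT f g) = mapT (f'.comp f) (g'.comp g) :=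
  CTensor.ext_clm fun x y => by simp

/-- The associativity map is never inverted: density of its range is enough to compare multipliers
across it. -/
theorem denseRange_assocT : DenseRange (assocT 𝕜 E F G) := by
  have h : ∀ z, z ∈ (LinearMap.range (assocT 𝕜 E F G).toLinearMap).topologicalClosure := by
    refine fun z => CTensor.mem_of_forall_tmul _ (Submodule.isClosed_topologicalClosure _) ?_ z
    intro x w
    let W := (LinearMap.range (assocT 𝕜 E F G).toLinearMap).topologicalClosure
    have hW : IsClosed (W : Set (CTensor 𝕜 E (CTensor 𝕜 F G))) := Submodule.isClosed_topologicalClosure _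
    let L : CTensor 𝕜 F G →L[𝕜] CTensor 𝕜 E (CTensor 𝕜 F G) := tmulL x
    refine CTensor.mem_of_forall_tmul (W.comap L.toLinearMap) (hW.preimage L.continuous) ?_ w
    intro y v
    exact Submodule.le_topologicalClosure _ ⟨tmul (tmul x y) v, assocT_tmul x y v⟩
  exact h

/-- The flip `x ⊗ y ↦ y ⊗ x`. -/
def swapT : CTensor 𝕜 E F →L[𝕜] CTensor 𝕜 F E := lift tmulL.flip

@[simp]
theorem swapT_tmul (x : E) (y : F) : swapT (tmul x y : CTensor 𝕜 E F) = tmul y x := by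
  simp [swapT]

attribute [simp] assocT_tmul sliceLeft_tmul sliceRight_tmul

end TensorInduction

/-! ### Approximate identities, nondegeneracy and multipliers -/

section Nondegenerate

variable {𝕜 A B : Type*} [NontriviallyNormedField 𝕜]
  [NonUnitalNormedRing A] [NormedSpace 𝕜 A] [SMulCommClass 𝕜 A A] [IsScalarTower 𝕜 A A]
  [NonUnitalNormedRing B] [NormedSpace 𝕜 B] [SMulCommClass 𝕜 B B] [IsScalarTower 𝕜 B B]

/-- A is recovered as the limit of products with the approximate identity. Combined with
`HasBoundedApproximateIdentity.ctensor`, this supplies nondegeneracy of the tensor powers of `A`. -/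
theorem HasBoundedApproximateIdentity.nondegenerateProduct
    (h : HasBoundedApproximateIdentity A) : NondegenerateProduct A := by
  obtain ⟨l, hl, -⟩ := h
  have := hl.neBot
  refine ⟨fun a ha => ?_, fun a ha => ?_⟩
  · exact tendsto_nhds_unique (hl.tendsto_mul_left a) (by simp [ha])
  · exact tendsto_nhds_unique (hl.tendsto_mul_right a) (by simp [ha])

theorem tendsto_clm_of_dense {E G I : Type*} [NormedAddCommGroup E] [NormedSpace 𝕜 E]
    [NormedAddCommGroup G] [NormedSpace 𝕜 G] {l : Filter I} (T : I → E →L[𝕜] G) (T₀ : E →L[𝕜] G)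
    {C : ℝ} (hC : ∀ᶠ i in l, ‖T i‖ ≤ C) (W : Set E) (hW : Dense W)
    (h : ∀ x ∈ W, Filter.Tendsto (fun i => T i x) l (nhds (T₀ x))) (x : E) :
    Filter.Tendsto (fun i => T i x) l (nhds (T₀ x)) := by
  rw [Metric.tendsto_nhds]
  intro ε hε
  set K := max C 0 + ‖T₀‖ + 1
  have hK : 0 < K := by positivity
  obtain ⟨y, hy, hxy⟩ := Metric.dense_iff.1 hW x (ε / (2 * K)) (by positivity)
  rw [Metric.mem_ball, dist_comm, dist_eq_norm] at hy
  filter_upwards [hC, (Metric.tendsto_nhds.1 (h y hxy)) (ε / 2) (by positivity)] with i hi hi'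
  rw [dist_eq_norm] at hi' ⊢
  have e : T i x - T₀ x = T i (x - y) - T₀ (x - y) + (T i y - T₀ y) := by
    simp only [map_sub]; abel
  rw [e]
  have h1 : ‖T i (x - y)‖ ≤ max C 0 * ‖x - y‖ :=
    (T i).le_of_opNorm_le (hi.trans (le_max_left _ _)) _
  have h2 : ‖T₀ (x - y)‖ ≤ ‖T₀‖ * ‖x - y‖ := T₀.le_opNorm _
  have h3 : K * ‖x - y‖ < ε / 2 := by
    calc K * ‖x - y‖ < K * (ε / (2 * K)) := by gcongr
      _ = ε / 2 := by field_simp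
  have h4 : 0 ≤ ‖x - y‖ := norm_nonneg _
  have h5 := norm_add_le (T i (x - y) - T₀ (x - y)) (T i y - T₀ y)
  have h6 := norm_sub_le (T i (x - y)) (T₀ (x - y))
  have h7 : K * ‖x - y‖ = max C 0 * ‖x - y‖ + ‖T₀‖ * ‖x - y‖ + ‖x - y‖ := by ring
  linarith

theorem tendsto_clm_ctensor {E F G I : Type*} [NormedAddCommGroup E] [NormedSpace 𝕜 E]
    [NormedAddCommGroup F] [NormedSpace 𝕜 F]
    [NormedAddCommGroup G] [NormedSpace 𝕜 G] {l : Filter I} (T : I → CTensor 𝕜 E F →L[𝕜] G)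
    (T₀ : CTensor 𝕜 E F →L[𝕜] G)
    {C : ℝ} (hC : ∀ᶠ i in l, ‖T i‖ ≤ C)
    (h : ∀ x y, Filter.Tendsto (fun i => T i (tmul x y)) l (nhds (T₀ (tmul x y))))
    (z : CTensor 𝕜 E F) :
    Filter.Tendsto (fun i => T i z) l (nhds (T₀ z)) := by
  let W : Submodule 𝕜 (CTensor 𝕜 E F) :=
    { carrier := {z | Filter.Tendsto (fun i => T i z) l (nhds (T₀ z))}
      add_mem' := fun {a b} ha hb => by
        simp only [Set.mem_ofPred_eq, map_add] at *
        exact ha.add hb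
      zero_mem' := by simpa using tendsto_const_nhds
      smul_mem' := fun k a ha => by
        simp only [Set.mem_ofPred_eq, map_smul] at *
        exact ha.const_smul k }
  refine tendsto_clm_of_dense T T₀ hC W (fun z => ?_) (fun x hx => hx) z
  exact CTensor.mem_of_forall_tmul W.topologicalClosure (Submodule.isClosed_topologicalClosure _)
    (fun x y => Submodule.le_topologicalClosure _ (h x y)) z

/-- The net e ⊗ e' is bounded, so its convergence need only be checked on elementary tensors. -/
theorem HasBoundedApproximateIdentity.ctensor (hA : HasBoundedApproximateIdentity A)
    (hB : HasBoundedApproximateIdentity B) : HasBoundedApproximateIdentity (CTensor 𝕜 A B) := by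
  obtain ⟨l, hl, C, hC⟩ := hA
  obtain ⟨l', hl', C', hC'⟩ := hB
  have := hl.neBot
  have := hl'.neBot
  have hb : ∀ᶠ p in l ×ˢ l', ‖(tmul p.1 p.2 : CTensor 𝕜 A B)‖ ≤ C * C' := by
    filter_upwards [hC.prod_mk hC'] with p hp
    refine (norm_tmul_le _ _).trans ?_
    exact mul_le_mul hp.1 hp.2 (norm_nonneg _) ((norm_nonneg _).trans hp.1)
  have htm : Continuous fun p : A × B => (tmul p.1 p.2 : CTensor 𝕜 A B) := by fun_prop
  refine ⟨(l ×ˢ l').map fun p => tmul p.1 p.2, ⟨fun z => ?_, fun z => ?_⟩, C * C', hb⟩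
  · rw [Filter.tendsto_map'_iff]
    refine tendsto_clm_ctensor
      (fun p : A × B => (ContinuousLinearMap.mul 𝕜 (CTensor 𝕜 A B)).flip (tmul p.1 p.2))
      (.id 𝕜 _) (C := C * C') ?_ ?_ z
    · filter_upwards [hb] with p hp
      exact (ContinuousLinearMap.opNorm_le_bound _ (norm_nonneg _) fun y =>
          (norm_mul_le y _).trans_eq (mul_comm _ _)).trans hp
    · intro x y
      have h1 : Filter.Tendsto (fun p : A × B => (x * p.1, y * p.2)) (l ×ˢ l') (nhds (x, y)) :=
        ((hl.tendsto_mul_left x).comp Filter.tendsto_fst).prodMk_nhds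
          ((hl'.tendsto_mul_left y).comp Filter.tendsto_snd)
      simpa [Function.comp_def] using! (htm.tendsto (x, y)).comp h1
  · rw [Filter.tendsto_map'_iff]
    refine tendsto_clm_ctensor
      (fun p : A × B => ContinuousLinearMap.mul 𝕜 (CTensor 𝕜 A B) (tmul p.1 p.2))
      (.id 𝕜 _) (C := C * C') ?_ ?_ z
    · filter_upwards [hb] with p hp
      exact (ContinuousLinearMap.opNorm_mul_apply_le 𝕜 _ _).trans hp
    · intro x y
      have h1 : Filter.Tendsto (fun p : A × B => (p.1 * x, p.2 * y)) (l ×ˢ l') (nhds (x, y)) :=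
        ((hl.tendsto_mul_right x).comp Filter.tendsto_fst).prodMk_nhds
          ((hl'.tendsto_mul_right y).comp Filter.tendsto_snd)
      simpa [Function.comp_def] using! (htm.tendsto (x, y)).comp h1

omit [SMulCommClass 𝕜 A A] [IsScalarTower 𝕜 A A] in
theorem HasBoundedApproximateIdentity.dense_span_mul (hA : HasBoundedApproximateIdentity A) :
    Dense (Submodule.span 𝕜 (Set.range fun p : A × A => p.1 * p.2) : Set A) := by
  obtain ⟨l, hl, -⟩ := hA
  have := hl.neBot
  intro a
  refine mem_closure_of_tendsto (hl.tendsto_mul_left a) (Filter.Eventually.of_forall fun e => ?_)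
  exact Submodule.subset_span ⟨(a, e), rfl⟩

/-- A tensor killed by left multiplication in the first leg vanishes. -/
theorem HasBoundedApproximateIdentity.eq_of_mapT_mul {F : Type*} [NormedAddCommGroup F]
    [NormedSpace 𝕜 F] (hA : HasBoundedApproximateIdentity A) {z w : CTensor 𝕜 A F}
    (h : ∀ d : A, mapT (ContinuousLinearMap.mul 𝕜 A d) (.id 𝕜 F) z =
      mapT (ContinuousLinearMap.mul 𝕜 A d) (.id 𝕜 F) w) : z = w := by
  obtain ⟨l, hl, C, hC⟩ := hA
  have := hl.neBot
  have key : ∀ z : CTensor 𝕜 A F, Filter.Tendsto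
      (fun d : A => mapT (ContinuousLinearMap.mul 𝕜 A d) (.id 𝕜 F) z) l (nhds z) := fun z => by
    refine tendsto_clm_ctensor (fun d : A => mapT (ContinuousLinearMap.mul 𝕜 A d) (.id 𝕜 F))
      (.id 𝕜 _) (C := C) ?_ (fun x y => ?_) z
    · filter_upwards [hC] with d hd
      refine (norm_mapT_le _ _).trans ?_
      calc _ ≤ ‖d‖ * 1 := by
            gcongr
            · exact ContinuousLinearMap.opNorm_mul_apply_le 𝕜 A d
            · exact ContinuousLinearMap.norm_id_le
        _ ≤ C := by rwa [mul_one]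
    · simpa [Function.comp_def] using! (((tmulL (𝕜 := 𝕜) (E := A) (F := F)).flip y).continuous.tendsto x).comp (hl.tendsto_mul_right x)
  exact tendsto_nhds_unique (key z) (by simpa only [h] using key w)

/-- Centrality and nondegeneracy recover the right action from the left one, so multiplier
identities are checked on left actions alone. -/
theorem multiplier_ext (hA : NondegenerateProduct A) {m n : 𝓜(𝕜, A)}
    (h : ∀ a, m.fst a = n.fst a) : m = n := by
  refine DoubleCentralizer.ext _ _ _ _ (Prod.ext (ContinuousLinearMap.ext h)
    (ContinuousLinearMap.ext fun a => ?_))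
  rw [← sub_eq_zero]
  refine hA.1 _ fun b => ?_
  rw [sub_mul, m.central, n.central, h, sub_self]

theorem toM_injective (hA : NondegenerateProduct A) {a b : A}
    (h : (toM a : 𝓜(𝕜, A)) = toM b) : a = b := by
  rw [← sub_eq_zero]
  refine hA.1 _ fun c => ?_
  have := congrArg (fun m : 𝓜(𝕜, A) => m.fst c) h
  simpa [sub_mul, sub_eq_zero] using this

theorem toM_fst_apply (hA : NondegenerateProduct A) (m : 𝓜(𝕜, A)) (a : A) :
    toM (m.fst a) = m * toM a :=
  multiplier_ext hA fun b => (fst_mul hA m a b).symm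

theorem toM_snd_apply (hA : NondegenerateProduct A) (m : 𝓜(𝕜, A)) (a : A) :
    toM (m.snd a) = toM a * m :=
  multiplier_ext hA fun b => m.central a b

theorem toM_mul (a b : A) : (toM (a * b) : 𝓜(𝕜, A)) = toM a * toM b :=
  DoubleCentralizer.ext _ _ _ _ (Prod.ext (ContinuousLinearMap.ext fun c => mul_assoc a b c)
    (ContinuousLinearMap.ext fun c => (mul_assoc c a b).symm))

theorem mul_fst_apply (m n : 𝓜(𝕜, A)) (a : A) : (m * n).fst a = m.fst (n.fst a) := rfl

theorem tensorM_mul (m m' : 𝓜(𝕜, A)) (n n' : 𝓜(𝕜, B)) :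
    tensorM (m * m') (n * n') = tensorM m n * tensorM m' n' :=
  DoubleCentralizer.ext _ _ _ _ (Prod.ext (mapT_comp _ _ _ _).symm (mapT_comp _ _ _ _).symm)

theorem toM_tmul (a : A) (b : B) :
    (toM (tmul a b) : 𝓜(𝕜, CTensor 𝕜 A B)) = tensorM (toM a) (toM b) :=
  DoubleCentralizer.ext _ _ _ _ (Prod.ext (CTensor.ext_clm fun x y => by simp)
    (CTensor.ext_clm fun x y => by simp))

omit [SMulCommClass 𝕜 A A] [IsScalarTower 𝕜 A A] in
theorem multiplier_eq_of_mul_eq {Φ : A →L[𝕜] 𝓜(𝕜, B)} (hB : NondegenerateProduct B)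
    (hΦ : IsNondegenerateHom Φ) {m n : 𝓜(𝕜, B)} (h : ∀ a, m * Φ a = n * Φ a) : m = n := by
  refine multiplier_ext hB fun b => DFunLike.congr_fun (ContinuousLinearMap.ext_on hΦ.1
    (f := m.fst) (g := n.fst) ?_) b
  rintro _ ⟨⟨a, b⟩, rfl⟩
  exact congrArg (fun m : 𝓜(𝕜, B) => m.fst b) (h a)

theorem IsExtensionAt.map_fst {Φ : A →L[𝕜] 𝓜(𝕜, B)} (hB : NondegenerateProduct B)
    {m : 𝓜(𝕜, A)} {n : 𝓜(𝕜, B)} (h : IsExtensionAt Φ m n) (a : A) :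
    Φ (m.fst a) = n * Φ a :=
  multiplier_ext hB fun b => ((h a b).1).symm

theorem IsExtensionAt.map_snd {Φ : A →L[𝕜] 𝓜(𝕜, B)}
    {m : 𝓜(𝕜, A)} {n : 𝓜(𝕜, B)} (hB : NondegenerateProduct B) (h : IsExtensionAt Φ m n) (a : A) :
    Φ (m.snd a) = Φ a * n := by
  refine multiplier_ext hB fun b => ?_
  rw [← sub_eq_zero]
  refine hB.2 _ fun c => ?_
  rw [mul_sub, ← DoubleCentralizer.central, ← DoubleCentralizer.central, sub_eq_zero]
  exact congrArg (· * b) ((h a c).2).symm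

theorem isNondegenerateHom_toM (hA : HasBoundedApproximateIdentity A) :
    IsNondegenerateHom (toM : A →L[𝕜] 𝓜(𝕜, A)) := by
  refine ⟨hA.dense_span_mul, ?_⟩
  convert hA.dense_span_mul (𝕜 := 𝕜) using 3
  ext x
  constructor
  · rintro ⟨⟨a, b⟩, rfl⟩; exact ⟨(b, a), rfl⟩
  · rintro ⟨⟨a, b⟩, rfl⟩; exact ⟨(b, a), rfl⟩

end Nondegenerate

/-! ### Tensor products of homomorphisms -/

section TensorHom

variable {𝕜 A B A' B' : Type*} [NontriviallyNormedField 𝕜]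
  [NonUnitalNormedRing A] [NormedSpace 𝕜 A] [SMulCommClass 𝕜 A A] [IsScalarTower 𝕜 A A]
  [NonUnitalNormedRing B] [NormedSpace 𝕜 B] [SMulCommClass 𝕜 B B] [IsScalarTower 𝕜 B B]
  [NonUnitalNormedRing A'] [NormedSpace 𝕜 A'] [SMulCommClass 𝕜 A' A'] [IsScalarTower 𝕜 A' A']
  [NonUnitalNormedRing B'] [NormedSpace 𝕜 B'] [SMulCommClass 𝕜 B' B'] [IsScalarTower 𝕜 B' B']

/-- The tensor product of two homomorphisms into multiplier algebras. -/
def tensorHom (Φ : A →L[𝕜] 𝓜(𝕜, B)) (Ψ : A' →L[𝕜] 𝓜(𝕜, B')) :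
    CTensor 𝕜 A A' →L[𝕜] 𝓜(𝕜, CTensor 𝕜 B B') :=
  lift (tensorML.bilinearComp Φ Ψ)

@[simp]
theorem tensorHom_tmul (Φ : A →L[𝕜] 𝓜(𝕜, B)) (Ψ : A' →L[𝕜] 𝓜(𝕜, B')) (a : A) (a' : A') :
    tensorHom Φ Ψ (tmul a a') = tensorM (Φ a) (Ψ a') := by
  simp [tensorHom]

theorem tensorHom_mul {Φ : A →L[𝕜] 𝓜(𝕜, B)} {Ψ : A' →L[𝕜] 𝓜(𝕜, B')}
    (hΦ : ∀ a b, Φ (a * b) = Φ a * Φ b) (hΨ : ∀ a b, Ψ (a * b) = Ψ a * Ψ b)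
    (z w : CTensor 𝕜 A A') :
    tensorHom Φ Ψ (z * w) = tensorHom Φ Ψ z * tensorHom Φ Ψ w := by
  refine CTensor.congr_clm
    ((tensorHom Φ Ψ).comp ((ContinuousLinearMap.mul 𝕜 (CTensor 𝕜 A A')).flip w))
    (((ContinuousLinearMap.mul 𝕜 𝓜(𝕜, CTensor 𝕜 B B')).flip (tensorHom Φ Ψ w)).comp
      (tensorHom Φ Ψ)) (fun x y => ?_) z
  refine CTensor.congr_clm
    ((tensorHom Φ Ψ).comp ((ContinuousLinearMap.mul 𝕜 (CTensor 𝕜 A A')) (tmul x y)))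
    (((ContinuousLinearMap.mul 𝕜 𝓜(𝕜, CTensor 𝕜 B B')) (tensorHom Φ Ψ (tmul x y))).comp
      (tensorHom Φ Ψ)) (fun x' y' => ?_) w
  simp [hΦ, hΨ, tensorM_mul]

theorem IsNondegenerateHom.tensorHom {Φ : A →L[𝕜] 𝓜(𝕜, B)} {Ψ : A' →L[𝕜] 𝓜(𝕜, B')}
    (hΦ : IsNondegenerateHom Φ) (hΨ : IsNondegenerateHom Ψ) :
    IsNondegenerateHom (tensorHom Φ Ψ) := by
  refine ⟨(CTensor.dense_span_tmul hΦ.1 hΨ.1).mono (Submodule.span_mono ?_),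
    (CTensor.dense_span_tmul hΦ.2 hΨ.2).mono (Submodule.span_mono ?_)⟩
  · rintro _ ⟨⟨⟨a, b⟩, ⟨a', b'⟩⟩, rfl⟩
    exact ⟨(tmul a a', tmul b b'), by simp⟩
  · rintro _ ⟨⟨⟨a, b⟩, ⟨a', b'⟩⟩, rfl⟩
    exact ⟨(tmul a a', tmul b b'), by simp⟩

end TensorHom

/-! ### Nearly orthogonal families and functionals on completed tensors -/

section Orthogonal

variable {𝕜 E F : Type*} [NontriviallyNormedField 𝕜] [CompleteSpace 𝕜]
  [NormedAddCommGroup E] [NormedSpace 𝕜 E] [IsUltrametricDist E]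
  [NormedAddCommGroup F] [NormedSpace 𝕜 F]

/-- Finitely many vectors of an ultrametric space lie in the span of a `C`-orthogonal family. -/
theorem exists_orthogonal_family (s : Finset E) : ∀ C : ℝ, 1 < C → ∃ (n : ℕ) (x : Fin n → E),
    (∀ u ∈ s, u ∈ Submodule.span 𝕜 (Set.range x)) ∧
    ∀ (c : Fin n → 𝕜) (i : Fin n), ‖c i‖ * ‖x i‖ ≤ C * ‖∑ j, c j • x j‖ := by
  classical
  induction s using Finset.induction_on with
  | empty => exact fun C _ => ⟨0, Fin.elim0, by simp, fun _ i => i.elim0⟩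
  | insert u s _ ih =>
    intro C hC
    -- A factor √C is lost in the induction hypothesis and another in choosing `v` nearly closest to
    -- `u`; together they make C.
    have hr : 1 < √C := by rwa [Real.lt_sqrt zero_le_one, one_pow]
    have hrr : √C * √C = C := Real.mul_self_sqrt (by linarith)
    obtain ⟨n, x, hs, hx⟩ := ih √C hr
    set V := Submodule.span 𝕜 (Set.range x) with hV
    by_cases hu : u ∈ V
    · refine ⟨n, x, fun v hv => ?_, fun c i => (hx c i).trans ?_⟩
      · rcases Finset.mem_insert.1 hv with rfl | hv
        exacts [hu, hs v hv]
      · gcongr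
        nlinarith
    have : FiniteDimensional 𝕜 V := FiniteDimensional.span_of_finite 𝕜 (Set.finite_range x)
    have hcl : IsClosed (V : Set E) := V.closed_of_finiteDimensional
    have hne : (V : Set E).Nonempty := ⟨0, V.zero_mem⟩
    set D := Metric.infDist u V
    have hD : 0 < D := (hcl.notMem_iff_infDist_pos hne).1 hu
    obtain ⟨v, hv, huv⟩ := (Metric.infDist_lt_iff hne (r := √C * D)).1 (by nlinarith)
    rw [dist_eq_norm] at huv
    have key : ∀ (k : 𝕜), ∀ f ∈ V, ‖k‖ * D ≤ ‖k • (u - v) + f‖ := fun k f hf => by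
      rcases eq_or_ne k 0 with rfl | hk
      · simp
      · have h1 : D ≤ dist u (v - k⁻¹ • f) :=
          Metric.infDist_le_dist_of_mem (V.sub_mem hv (V.smul_mem _ hf))
        have h2 : k • (u - v) + f = k • (u - (v - k⁻¹ • f)) := by
          simp only [smul_sub, smul_inv_smul₀ hk]; abel
        rw [h2, norm_smul, ← dist_eq_norm]
        gcongr
    refine ⟨n + 1, Fin.cons (u - v) x, fun w hw => ?_, fun c i => ?_⟩
    · have hle : V ≤ Submodule.span 𝕜 (Set.range (Fin.cons (u - v) x : Fin (n + 1) → E)) :=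
        Submodule.span_mono (by rw [Fin.range_cons]; exact Set.subset_insert _ _)
      rcases Finset.mem_insert.1 hw with rfl | hw
      · have := add_mem (Submodule.subset_span (R := 𝕜)
          (Set.mem_range_self (f := (Fin.cons (w - v) x : Fin (n + 1) → E)) 0)) (hle hv)
        rwa [Fin.cons_zero, sub_add_cancel] at this
      · exact hle (hs w hw)
    · rw [Fin.sum_univ_succ]
      simp only [Fin.cons_zero, Fin.cons_succ]
      set f := ∑ j : Fin n, c j.succ • x j with hf
      have hfV : f ∈ V := V.sum_mem fun j _ => V.smul_mem _ (Submodule.subset_span ⟨j, rfl⟩)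
      set w := c 0 • (u - v) + f with hw
      have h0 : ‖c 0‖ * ‖u - v‖ ≤ √C * ‖w‖ := by
        have := key (c 0) f hfV
        calc ‖c 0‖ * ‖u - v‖ ≤ ‖c 0‖ * (√C * D) := by gcongr
          _ = √C * (‖c 0‖ * D) := by ring
          _ ≤ √C * ‖w‖ := by gcongr
      have hwn := norm_nonneg w
      refine Fin.cases ?_ (fun j => ?_) i
      · refine h0.trans ?_
        gcongr
        nlinarith
      -- Ultrametric inequality: both `w` and `c 0 • (u - v)` have norm at most √C ‖w‖.
      · have h1 : ‖f‖ ≤ √C * ‖w‖ := by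
          have : f = w + -(c 0 • (u - v)) := by rw [hw]; abel
          rw [this]
          refine (IsUltrametricDist.norm_add_le_max _ _).trans (max_le ?_ ?_)
          · nlinarith
          · rwa [norm_neg, norm_smul]
        calc ‖c j.succ‖ * ‖x j‖ ≤ √C * ‖f‖ := hx (fun j => c j.succ) j
          _ ≤ √C * (√C * ‖w‖) := by gcongr
          _ = C * ‖w‖ := by rw [← mul_assoc, hrr]

omit [CompleteSpace 𝕜] [IsUltrametricDist E] in
-- `s` collects the first legs of one representation of `g`. Expanding them in the `x i` and moving
-- the coefficients to the second leg rewrites `g` along any family that spans them.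
theorem AlgTensor.exists_finset (g : AlgTensor 𝕜 E F) : ∃ s : Finset E, ∀ (n : ℕ) (x : Fin n → E),
    (∀ u ∈ s, u ∈ Submodule.span 𝕜 (Set.range x)) →
    ∃ y : Fin n → F, g = ∑ i, AlgTensor.tmul (x i) (y i) := by
  classical
  refine TensorProduct.induction_on (motive := fun g : E ⊗[𝕜] F => ∃ s : Finset E,
    ∀ (n : ℕ) (x : Fin n → E), (∀ u ∈ s, u ∈ Submodule.span 𝕜 (Set.range x)) →
    ∃ y : Fin n → F, g = ∑ i, (x i ⊗ₜ[𝕜] y i)) g ?_ ?_ ?_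
  · exact ⟨∅, fun n x _ => ⟨0, by simp⟩⟩
  · refine fun u v => ⟨{u}, fun n x h => ?_⟩
    obtain ⟨c, rfl⟩ := (Submodule.mem_span_range_iff_exists_fun 𝕜).1 (h u (by simp))
    exact ⟨fun i => c i • v, by simp [TensorProduct.sum_tmul, TensorProduct.smul_tmul]⟩
  · rintro g h ⟨s, hs⟩ ⟨t, ht⟩
    refine ⟨s ∪ t, fun n x hx => ?_⟩
    obtain ⟨y, rfl⟩ := hs n x fun u hu => hx u (Finset.mem_union_left _ hu)
    obtain ⟨y', rfl⟩ := ht n x fun u hu => hx u (Finset.mem_union_right _ hu)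
    exact ⟨y + y', by simp [TensorProduct.tmul_add, Finset.sum_add_distrib]⟩

omit [CompleteSpace 𝕜] in
theorem norm_sliceRight_le [IsUltrametricDist 𝕜] [CompleteSpace E] (ω : F →L[𝕜] 𝕜) :
    ‖(sliceRight ω : CTensor 𝕜 E F →L[𝕜] E)‖ ≤ ‖ω‖ := by
  refine (norm_lift_le _).trans ?_
  rw [ContinuousLinearMap.opNorm_flip]
  refine (ContinuousLinearMap.opNorm_comp_le _ _).trans ?_
  exact mul_le_of_le_one_left (norm_nonneg _) ContinuousLinearMap.opNorm_lsmul_le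

/-- If all functionals `γ g` annihilate the second leg of `t`, then so does every functional
`γ (L x)` that depends on the first leg. -/
theorem lift_comp_eq_zero [IsUltrametricDist 𝕜] [CompleteSpace E] {G : Type*}
    [NormedAddCommGroup G] [NormedSpace 𝕜 G] (γ : G →L[𝕜] F →L[𝕜] 𝕜) (L : E →L[𝕜] G)
    (t : CTensor 𝕜 E F) (h : ∀ g, sliceRight (γ g) t = 0) : lift (γ.comp L) t = 0 := by
  set B := lift (γ.comp L)
  -- ‖B‖ controls the error of replacing `t` by a finite sum `z`, and 2‖γ‖‖L‖ controls `B z`, where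
  -- 2 is the orthogonality constant.
  set K := max ‖B‖ (2 * (‖γ‖ * ‖L‖)) + 1
  have hK : 0 < K := by positivity
  rw [← norm_le_zero_iff]
  refine le_of_forall_pos_le_add fun ε hε => ?_
  rw [zero_add]
  set η := ε / K
  have hη : 0 < η := by positivity
  obtain ⟨g, hg⟩ := UniformSpace.Completion.denseRange_coe.exists_dist_lt t hη
  rw [dist_eq_norm] at hg
  obtain ⟨s, hs⟩ := g.exists_finset
  obtain ⟨n, x, hx, hC⟩ := exists_orthogonal_family (𝕜 := 𝕜) s 2 one_lt_two
  obtain ⟨y, hy⟩ := hs n x hx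
  have hg' : (g : CTensor 𝕜 E F) = ∑ i, tmul (x i) (y i) := by
    rw [hy]
    exact map_sum (UniformSpace.Completion.toComplL (𝕜 := 𝕜) (E := AlgTensor 𝕜 E F)) _ _
  rw [hg'] at hg
  set z := ∑ i, (tmul (x i) (y i) : CTensor 𝕜 E F)
  have hKη : ∀ c, c ≤ max ‖B‖ (2 * (‖γ‖ * ‖L‖)) → c * η ≤ ε := fun c hc => by
    calc c * η ≤ K * η := by gcongr; linarith
      _ = ε := by simp only [η]; field_simp
  have h1 : ‖B (t - z)‖ ≤ ε :=
    (B.le_opNorm_of_le hg.le).trans (hKη _ (le_max_left _ _))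
  have h2 : ‖B z‖ ≤ ε := by
    simp only [z, map_sum]
    refine IsUltrametricDist.norm_sum_le_of_forall_le_of_nonneg hε.le fun i _ => ?_
    simp only [B, lift_tmul, ContinuousLinearMap.comp_apply]
    rcases eq_or_ne (x i) 0 with h0 | h0
    · simpa [h0] using hε.le
    have h0' : 0 < ‖x i‖ := norm_pos_iff.2 h0
    -- The i-th term of `B z` is also the i-th coefficient of the slice of `z` by `γ (L (x i))`, and
    -- orthogonality bounds it by that whole slice. The corresponding slice of `t` vanishes, so the
    -- slice of `z` is as small as `t - z`.
    have h3 := hC (fun j => γ (L (x i)) (y j)) i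
    have h4 : ∑ j, γ (L (x i)) (y j) • x j = - sliceRight (γ (L (x i))) (t - z) := by
      rw [map_sub, h, zero_sub, neg_neg]
      simp [z, map_sum]
    rw [h4, norm_neg] at h3
    have h5 : ‖sliceRight (E := E) (γ (L (x i))) (t - z)‖ ≤ ‖γ‖ * (‖L‖ * ‖x i‖) * η :=
      ContinuousLinearMap.le_of_opNorm_le_of_le _ ((norm_sliceRight_le _).trans
        (γ.le_opNorm_of_le (L.le_opNorm _))) hg.le
    refine (le_of_mul_le_mul_right ?_ h0').trans
      (hKη (2 * (‖γ‖ * ‖L‖)) (le_max_right _ _))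
    calc _ ≤ 2 * ‖sliceRight (E := E) (γ (L (x i))) (t - z)‖ := h3
      _ ≤ 2 * (‖γ‖ * (‖L‖ * ‖x i‖) * η) := by gcongr
      _ = _ := by ring
  have h6 : B t = B (t - z) + B z := by rw [map_sub]; abel
  rw [h6]
  exact (IsUltrametricDist.norm_add_le_max _ _).trans (max_le h1 h2)

end Orthogonal

/-! ### Multipliers of triple tensor products -/

section Associativity

variable {𝕜 E F G K : Type*} [NontriviallyNormedField 𝕜]
  [NormedAddCommGroup E] [NormedSpace 𝕜 E] [NormedAddCommGroup F] [NormedSpace 𝕜 F]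
  [NormedAddCommGroup G] [NormedSpace 𝕜 G] [NormedAddCommGroup K] [NormedSpace 𝕜 K]

theorem CTensor.congr_clm_left (f g : CTensor 𝕜 (CTensor 𝕜 E F) G →L[𝕜] K)
    (h : ∀ x y z, f (tmul (tmul x y) z) = g (tmul (tmul x y) z))
    (t : CTensor 𝕜 (CTensor 𝕜 E F) G) : f t = g t :=
  CTensor.congr_clm f g (fun w z => CTensor.congr_clm
    (f.comp ((tmulL (𝕜 := 𝕜) (E := CTensor 𝕜 E F) (F := G)).flip z))
    (g.comp ((tmulL (𝕜 := 𝕜) (E := CTensor 𝕜 E F) (F := G)).flip z)) (fun x y => h x y z) w) t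

variable {A : Type*} [NonUnitalNormedRing A] [NormedSpace 𝕜 A] [SMulCommClass 𝕜 A A]
  [IsScalarTower 𝕜 A A]

theorem assocT_mul (u v : CTensor 𝕜 (CTensor 𝕜 A A) A) :
    assocT 𝕜 A A A (u * v) = assocT 𝕜 A A A u * assocT 𝕜 A A A v := by
  refine CTensor.congr_clm_left
    ((assocT 𝕜 A A A).comp ((ContinuousLinearMap.mul 𝕜 _).flip v))
    (((ContinuousLinearMap.mul 𝕜 _).flip (assocT 𝕜 A A A v)).comp (assocT 𝕜 A A A))
    (fun x y z => ?_) u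
  refine CTensor.congr_clm_left
    ((assocT 𝕜 A A A).comp (ContinuousLinearMap.mul 𝕜 _ (tmul (tmul x y) z)))
    ((ContinuousLinearMap.mul 𝕜 _ (assocT 𝕜 A A A (tmul (tmul x y) z))).comp (assocT 𝕜 A A A))
    (fun x' y' z' => ?_) v
  simp

/-- Two multipliers of `(A ⊗ A) ⊗ A` and `A ⊗ (A ⊗ A)` correspond under associativity. -/
def AssocRel (M : 𝓜(𝕜, CTensor 𝕜 (CTensor 𝕜 A A) A)) (M' : 𝓜(𝕜, CTensor 𝕜 A (CTensor 𝕜 A A))) :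
    Prop :=
  ∀ z, assocT 𝕜 A A A (M.fst z) = M'.fst (assocT 𝕜 A A A z)

theorem AssocRel.mul {M N : 𝓜(𝕜, CTensor 𝕜 (CTensor 𝕜 A A) A)}
    {M' N' : 𝓜(𝕜, CTensor 𝕜 A (CTensor 𝕜 A A))} (h : AssocRel M M') (h' : AssocRel N N') :
    AssocRel (M * N) (M' * N') := fun z => by
  rw [mul_fst_apply, mul_fst_apply, h, h']

theorem assocRel_tensorM (m n k : 𝓜(𝕜, A)) :
    AssocRel (tensorM (A := CTensor 𝕜 A A) (B := A) (tensorM m n) k)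
      (tensorM (A := A) (B := CTensor 𝕜 A A) m (tensorM n k)) := fun z => by
  simp only [tensorM_fst]
  exact CTensor.congr_clm_left ((assocT 𝕜 A A A).comp (mapT (mapT m.fst n.fst) k.fst))
    ((mapT m.fst (mapT n.fst k.fst)).comp (assocT 𝕜 A A A)) (fun x y z => by simp) z

/-- Left multiplications need only be compared on the dense range of `assocT`, where
multiplicativity of `assocT` turns the relation into the claim. -/
theorem AssocRel.assocT_eq (hA : HasBoundedApproximateIdentity A)
    {u : CTensor 𝕜 (CTensor 𝕜 A A) A} {v : CTensor 𝕜 A (CTensor 𝕜 A A)}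
    (h : AssocRel (toM u) (toM v)) : assocT 𝕜 A A A u = v := by
  have hn := (hA.ctensor (𝕜 := 𝕜) (hA.ctensor (𝕜 := 𝕜) hA)).nondegenerateProduct
  refine toM_injective (𝕜 := 𝕜) hn (multiplier_ext hn fun a => ?_)
  refine congrFun (denseRange_assocT.equalizer (toM (assocT 𝕜 A A A u)).fst.continuous
    (toM v).fst.continuous (funext fun z => ?_)) a
  exact (assocT_mul u z).symm.trans (h z)

end Associativity

/-! ### Extensions of tensor product homomorphisms -/

section TensorHomExtension

variable {𝕜 A B A' B' : Type*} [NontriviallyNormedField 𝕜]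
  [NonUnitalNormedRing A] [NormedSpace 𝕜 A] [SMulCommClass 𝕜 A A] [IsScalarTower 𝕜 A A]
  [NonUnitalNormedRing B] [NormedSpace 𝕜 B] [SMulCommClass 𝕜 B B] [IsScalarTower 𝕜 B B]
  [NonUnitalNormedRing A'] [NormedSpace 𝕜 A'] [SMulCommClass 𝕜 A' A'] [IsScalarTower 𝕜 A' A']
  [NonUnitalNormedRing B'] [NormedSpace 𝕜 B'] [SMulCommClass 𝕜 B' B'] [IsScalarTower 𝕜 B' B']

theorem tensorHom_one_fst {Φ : A →L[𝕜] 𝓜(𝕜, B)} {Ψ : A' →L[𝕜] 𝓜(𝕜, B')}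
    (hΨ : ∀ a b, Ψ (a * b) = Ψ a * Ψ b) (w : A') (z : CTensor 𝕜 A A') :
    tensorHom Φ Ψ ((tensorM 1 (toM w)).fst z) = tensorM 1 (Ψ w) * tensorHom Φ Ψ z :=
  CTensor.congr_clm ((tensorHom Φ Ψ).comp (tensorM 1 (toM w)).fst)
    ((ContinuousLinearMap.mul 𝕜 _ (tensorM 1 (Ψ w))).comp (tensorHom Φ Ψ))
    (fun x y => by
      simp [hΨ, ← tensorM_mul]) z

theorem tensorHom_fst_one {Φ : A →L[𝕜] 𝓜(𝕜, B)} {Ψ : A' →L[𝕜] 𝓜(𝕜, B')}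
    (hΦ : ∀ a b, Φ (a * b) = Φ a * Φ b) (w : A) (z : CTensor 𝕜 A A') :
    tensorHom Φ Ψ ((tensorM (toM w) 1).fst z) = tensorM (Φ w) 1 * tensorHom Φ Ψ z :=
  CTensor.congr_clm ((tensorHom Φ Ψ).comp (tensorM (toM w) 1).fst)
    ((ContinuousLinearMap.mul 𝕜 _ (tensorM (Φ w) 1)).comp (tensorHom Φ Ψ))
    (fun x y => by
      simp [hΦ, ← tensorM_mul]) z

theorem isExtensionAt_extendM [CompleteSpace B] (hA : HasBoundedApproximateIdentity A)
    {Φ : A →L[𝕜] 𝓜(𝕜, B)} (hmul : ∀ a b, Φ (a * b) = Φ a * Φ b)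
    (hΦ : IsNondegenerateHom Φ) (m : 𝓜(𝕜, A)) : IsExtensionAt Φ m (extendM Φ m) := by
  have h := (existsUnique_isExtensionAt hA hA.nondegenerateProduct Φ hmul hΦ m).exists
  rw [extendM, dif_pos h]
  exact h.choose_spec

end TensorHomExtension

/-! ### Coassociativity expressed through T₁, …, T₄ -/

namespace MultiplierBanachHopf

variable {𝕜 A : Type*} [NontriviallyNormedField 𝕜]
  [NonUnitalNormedRing A] [NormedSpace 𝕜 A] [SMulCommClass 𝕜 A A] [IsScalarTower 𝕜 A A]
  (H : MultiplierBanachHopf 𝕜 A)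

/-- `T₁` as a continuous linear map. -/
def T₁L : CTensor 𝕜 A A →L[𝕜] CTensor 𝕜 A A := H.T₁.toContinuousLinearEquiv
/-- `T₂` as a continuous linear map. -/
def T₂L : CTensor 𝕜 A A →L[𝕜] CTensor 𝕜 A A := H.T₂.toContinuousLinearEquiv
/-- `T₃` as a continuous linear map. -/
def T₃L : CTensor 𝕜 A A →L[𝕜] CTensor 𝕜 A A := H.T₃.toContinuousLinearEquiv
/-- `T₄` as a continuous linear map. -/
def T₄L : CTensor 𝕜 A A →L[𝕜] CTensor 𝕜 A A := H.T₄.toContinuousLinearEquiv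
/-- The inverse of `T₁` as a continuous linear map. -/
def T₁inv : CTensor 𝕜 A A →L[𝕜] CTensor 𝕜 A A := H.T₁.symm.toContinuousLinearEquiv

@[simp] theorem T₁L_apply (z) : H.T₁L z = H.T₁ z := rfl
@[simp] theorem T₂L_apply (z) : H.T₂L z = H.T₂ z := rfl
@[simp] theorem T₃L_apply (z) : H.T₃L z = H.T₃ z := rfl
@[simp] theorem T₁inv_apply (z) : H.T₁inv z = H.T₁.symm z := rfl

/-- `a ↦ T₁(a ⊗ b)`. -/
def T₁R (b : A) : A →L[𝕜] CTensor 𝕜 A A := H.T₁L.comp (tmulL.flip b)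
/-- `b ↦ T₂(a ⊗ b)`. -/
def T₂R (a : A) : A →L[𝕜] CTensor 𝕜 A A := H.T₂L.comp (tmulL a)
/-- `a ↦ T₃(a ⊗ b)`. -/
def T₃R (b : A) : A →L[𝕜] CTensor 𝕜 A A := H.T₃L.comp (tmulL.flip b)
/-- `b ↦ T₄(a ⊗ b)`. -/
def T₄R (a : A) : A →L[𝕜] CTensor 𝕜 A A := H.T₄L.comp (tmulL a)

@[simp] theorem T₁R_apply (a b : A) : H.T₁R b a = H.T₁ (tmul a b) := rfl
@[simp] theorem T₂R_apply (a b : A) : H.T₂R a b = H.T₂ (tmul a b) := rfl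
@[simp] theorem T₃R_apply (a b : A) : H.T₃R b a = H.T₃ (tmul a b) := rfl
@[simp] theorem T₄R_apply (a b : A) : H.T₄R a b = H.T₄ (tmul a b) := rfl

variable (hA : HasBoundedApproximateIdentity A)
include hA

theorem nondegenerate_ctensor : NondegenerateProduct (CTensor 𝕜 A A) :=
  (hA.ctensor (𝕜 := 𝕜) hA).nondegenerateProduct

theorem isExtensionAt_left (a : A) :
    IsExtensionAt (tensorHom H.Δ toM) (H.Δ a) (extendM (comulTensorId H.Δ) (H.Δ a)) :=
  isExtensionAt_extendM (hA.ctensor hA) (tensorHom_mul H.map_mul toM_mul)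
    (H.nondegenerate.tensorHom (isNondegenerateHom_toM hA)) _

theorem isExtensionAt_right (a : A) :
    IsExtensionAt (tensorHom toM H.Δ) (H.Δ a) (extendM (idTensorComul H.Δ) (H.Δ a)) :=
  isExtensionAt_extendM (hA.ctensor hA) (tensorHom_mul toM_mul H.map_mul)
    ((isNondegenerateHom_toM hA).tensorHom H.nondegenerate) _

/-- After right multiplication by (Δ ⊗ id)(z) this is multiplicativity of Δ ⊗ id together with the
property defining its extension at Δ(a). This lemma and its three variants replace the extensions in
`IsCoassociative` by values on elements of A ⊗ A. -/
theorem tensorHom_left_T₁ (a w : A) : tensorHom H.Δ toM (H.T₁ (tmul a w)) =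
    extendM (comulTensorId H.Δ) (H.Δ a) * tensorM 1 (toM w) := by
  have hE := ((hA.ctensor (𝕜 := 𝕜) hA).ctensor (𝕜 := 𝕜) hA).nondegenerateProduct
  refine multiplier_eq_of_mul_eq hE (H.nondegenerate.tensorHom (isNondegenerateHom_toM hA))
    fun z => ?_
  rw [← tensorHom_mul H.map_mul toM_mul, mul_assoc, ← tensorHom_one_fst toM_mul,
    ← (H.isExtensionAt_left hA a).map_fst hE]
  exact congrArg (fun m => tensorHom H.Δ toM (m.fst z)) (H.T₁_spec a w)

theorem tensorHom_left_T₃ (a w : A) : tensorHom H.Δ toM (H.T₃ (tmul a w)) =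
    tensorM 1 (toM w) * extendM (comulTensorId H.Δ) (H.Δ a) := by
  have hE := ((hA.ctensor (𝕜 := 𝕜) hA).ctensor (𝕜 := 𝕜) hA).nondegenerateProduct
  refine multiplier_eq_of_mul_eq hE (H.nondegenerate.tensorHom (isNondegenerateHom_toM hA))
    fun z => ?_
  rw [← tensorHom_mul H.map_mul toM_mul, mul_assoc, ← (H.isExtensionAt_left hA a).map_fst hE,
    ← tensorHom_one_fst toM_mul]
  exact congrArg (fun m => tensorHom H.Δ toM (m.fst z)) (H.T₃_spec a w)

theorem tensorHom_right_T₂ (d a : A) : tensorHom toM H.Δ (H.T₂ (tmul d a)) =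
    tensorM (toM d) 1 * extendM (idTensorComul H.Δ) (H.Δ a) := by
  have hE := (hA.ctensor (𝕜 := 𝕜) (hA.ctensor (𝕜 := 𝕜) hA)).nondegenerateProduct
  refine multiplier_eq_of_mul_eq hE ((isNondegenerateHom_toM hA).tensorHom H.nondegenerate)
    fun z => ?_
  rw [← tensorHom_mul toM_mul H.map_mul, mul_assoc, ← (H.isExtensionAt_right hA a).map_fst hE,
    ← tensorHom_fst_one toM_mul]
  exact congrArg (fun m => tensorHom toM H.Δ (m.fst z)) (H.T₂_spec d a)

theorem tensorHom_right_T₄ (d a : A) : tensorHom toM H.Δ (H.T₄ (tmul d a)) =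
    extendM (idTensorComul H.Δ) (H.Δ a) * tensorM (toM d) 1 := by
  have hE := (hA.ctensor (𝕜 := 𝕜) (hA.ctensor (𝕜 := 𝕜) hA)).nondegenerateProduct
  refine multiplier_eq_of_mul_eq hE ((isNondegenerateHom_toM hA).tensorHom H.nondegenerate)
    fun z => ?_
  rw [← tensorHom_mul toM_mul H.map_mul, mul_assoc, ← tensorHom_fst_one toM_mul,
    ← (H.isExtensionAt_right hA a).map_fst hE]
  exact congrArg (fun m => tensorHom toM H.Δ (m.fst z)) (H.T₄_spec d a)

omit hA in
theorem toM_mapT_T₂ (d : A) (z : CTensor 𝕜 A A) :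
    toM (mapT (H.T₂R d) (.id 𝕜 A) z) =
      tensorM (tensorM (toM d) 1) 1 * tensorHom H.Δ toM z :=
  CTensor.congr_clm (toM.comp (mapT (H.T₂R d) (.id 𝕜 A)))
    ((ContinuousLinearMap.mul 𝕜 _ (tensorM (tensorM (toM d) 1) 1)).comp (tensorHom H.Δ toM))
    (fun x y => by simp [toM_tmul, H.T₂_spec, ← tensorM_mul]) z

omit hA in
theorem toM_mapT_T₄ (d : A) (z : CTensor 𝕜 A A) :
    toM (mapT (H.T₄R d) (.id 𝕜 A) z) =
      tensorHom H.Δ toM z * tensorM (tensorM (toM d) 1) 1 :=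
  CTensor.congr_clm (toM.comp (mapT (H.T₄R d) (.id 𝕜 A)))
    (((ContinuousLinearMap.mul 𝕜 𝓜(𝕜, CTensor 𝕜 (CTensor 𝕜 A A) A)).flip
      (tensorM (tensorM (toM d) 1) 1)).comp
      (tensorHom H.Δ toM))
    (fun x y => by simp [toM_tmul, H.T₄_spec, ← tensorM_mul]) z

omit hA in
theorem toM_mapT_T₁ (w : A) (z : CTensor 𝕜 A A) :
    toM (mapT (.id 𝕜 A) (H.T₁R w) z) =
      tensorHom toM H.Δ z * tensorM 1 (tensorM 1 (toM w)) :=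
  CTensor.congr_clm (toM.comp (mapT (.id 𝕜 A) (H.T₁R w)))
    (((ContinuousLinearMap.mul 𝕜 𝓜(𝕜, CTensor 𝕜 A (CTensor 𝕜 A A))).flip
      (tensorM 1 (tensorM 1 (toM w)))).comp
      (tensorHom toM H.Δ))
    (fun x y => by simp [toM_tmul, H.T₁_spec, ← tensorM_mul]) z

omit hA in
theorem toM_mapT_T₃ (w : A) (z : CTensor 𝕜 A A) :
    toM (mapT (.id 𝕜 A) (H.T₃R w) z) =
      tensorM 1 (tensorM 1 (toM w)) * tensorHom toM H.Δ z :=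
  CTensor.congr_clm (toM.comp (mapT (.id 𝕜 A) (H.T₃R w)))
    ((ContinuousLinearMap.mul 𝕜 _ (tensorM 1 (tensorM 1 (toM w)))).comp
      (tensorHom toM H.Δ))
    (fun x y => by simp [toM_tmul, H.T₃_spec, ← tensorM_mul]) z

omit hA in
theorem assocRel_comul (a : A) : AssocRel (extendM (comulTensorId H.Δ) (H.Δ a))
    (extendM (idTensorComul H.Δ) (H.Δ a)) := fun z => (H.coassoc a z).1

omit hA in
theorem tensorM_one_one : tensorM (1 : 𝓜(𝕜, A)) (1 : 𝓜(𝕜, A)) = 1 :=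
  DoubleCentralizer.ext _ _ _ _ (Prod.ext (ContinuousLinearMap.ext mapT_id_id)
    (ContinuousLinearMap.ext mapT_id_id))

/-- `(T₂ ⊗ id)(id ⊗ T₁) = (id ⊗ T₁)(T₂ ⊗ id)`. -/
theorem coassoc_T₂_T₁ (d a w : A) :
    assocT 𝕜 A A A (mapT (H.T₂R d) (.id 𝕜 A) (H.T₁ (tmul a w))) =
      mapT (.id 𝕜 A) (H.T₁R w) (H.T₂ (tmul d a)) := by
  refine AssocRel.assocT_eq hA ?_
  -- With Δ² denoting the iterated coproduct, both sides are (d ⊗ 1 ⊗ 1) Δ²(a) (1 ⊗ 1 ⊗ w).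
  rw [H.toM_mapT_T₂, H.toM_mapT_T₁, H.tensorHom_left_T₁ hA, H.tensorHom_right_T₂ hA, ← mul_assoc]
  have h1 := assocRel_tensorM (toM d) (1 : 𝓜(𝕜, A)) 1
  have h2 := assocRel_tensorM 1 (1 : 𝓜(𝕜, A)) (toM w)
  rw [tensorM_one_one] at h1 h2
  exact (h1.mul (H.assocRel_comul a)).mul h2

/-- `(T₄ ⊗ id)(id ⊗ T₃) = (id ⊗ T₃)(T₄ ⊗ id)`. -/
theorem coassoc_T₄_T₃ (d a w : A) :
    assocT 𝕜 A A A (mapT (H.T₄R d) (.id 𝕜 A) (H.T₃ (tmul a w))) =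
      mapT (.id 𝕜 A) (H.T₃R w) (H.T₄ (tmul d a)) := by
  refine AssocRel.assocT_eq hA ?_
  -- Both sides are (1 ⊗ 1 ⊗ w) Δ²(a) (d ⊗ 1 ⊗ 1).
  rw [H.toM_mapT_T₄, H.toM_mapT_T₃, H.tensorHom_left_T₃ hA, H.tensorHom_right_T₄ hA, mul_assoc]
  have h1 := assocRel_tensorM (toM d) (1 : 𝓜(𝕜, A)) 1
  have h2 := assocRel_tensorM 1 (1 : 𝓜(𝕜, A)) (toM w)
  rw [tensorM_one_one] at h1 h2
  exact h2.mul ((H.assocRel_comul a).mul h1)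

end MultiplierBanachHopf

/-! ### Naturality of slice maps -/

section Slices

variable {𝕜 E F E' F' G : Type*} [NontriviallyNormedField 𝕜]
  [NormedAddCommGroup E] [NormedSpace 𝕜 E] [NormedAddCommGroup F] [NormedSpace 𝕜 F]
  [NormedAddCommGroup E'] [NormedSpace 𝕜 E'] [NormedAddCommGroup F'] [NormedSpace 𝕜 F']
  [NormedAddCommGroup G] [NormedSpace 𝕜 G]

theorem sliceLeft_mapT [CompleteSpace F] [IsUltrametricDist F] [CompleteSpace F']
    [IsUltrametricDist F'] (ω : E' →L[𝕜] 𝕜) (f : E →L[𝕜] E') (g : F →L[𝕜] F')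
    (z : CTensor 𝕜 E F) : sliceLeft ω (mapT f g z) = g (sliceLeft (ω.comp f) z) :=
  CTensor.congr_clm ((sliceLeft ω).comp (mapT f g)) (g.comp (sliceLeft (ω.comp f)))
    (fun x y => by simp) z

theorem sliceRight_mapT [CompleteSpace E] [IsUltrametricDist E] [CompleteSpace E']
    [IsUltrametricDist E'] (ω : F' →L[𝕜] 𝕜) (f : E →L[𝕜] E') (g : F →L[𝕜] F')
    (z : CTensor 𝕜 E F) : sliceRight ω (mapT f g z) = f (sliceRight (ω.comp g) z) :=
  CTensor.congr_clm ((sliceRight ω).comp (mapT f g)) (f.comp (sliceRight (ω.comp g)))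
    (fun x y => by simp) z

theorem apply_sliceLeft_eq [CompleteSpace F] [IsUltrametricDist F] [CompleteSpace E]
    [IsUltrametricDist E] (ω : E →L[𝕜] 𝕜) (η : F →L[𝕜] 𝕜)
    (z : CTensor 𝕜 E F) : η (sliceLeft ω z) = ω (sliceRight η z) :=
  CTensor.congr_clm (η.comp (sliceLeft ω)) (ω.comp (sliceRight η))
    (fun x y => by simp [mul_comm]) z

theorem mapT_id_assocT_tmul (Θ : CTensor 𝕜 F G →L[𝕜] F') (t : CTensor 𝕜 E F) (c : G) :
    mapT (.id 𝕜 E) Θ (assocT 𝕜 E F G (tmul t c)) =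
      mapT (.id 𝕜 E) (Θ.comp ((tmulL (𝕜 := 𝕜) (E := F) (F := G)).flip c)) t :=
  CTensor.congr_clm ((mapT (.id 𝕜 E) Θ).comp
      ((assocT 𝕜 E F G).comp ((tmulL (𝕜 := 𝕜) (E := CTensor 𝕜 E F) (F := G)).flip c)))
    (mapT (.id 𝕜 E) (Θ.comp ((tmulL (𝕜 := 𝕜) (E := F) (F := G)).flip c)))
    (fun x y => by simp) t

end Slices

/-! ### The counit -/

namespace MultiplierBanachHopf

variable {𝕜 A : Type*} [NontriviallyNormedField 𝕜]
  [NonUnitalNormedRing A] [NormedSpace 𝕜 A] [SMulCommClass 𝕜 A A] [IsScalarTower 𝕜 A A]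
  (H : MultiplierBanachHopf 𝕜 A)

/-- `lm d` is left multiplication by `d`. -/
local notation "lm" => ContinuousLinearMap.mul 𝕜 A
/-- `rm d` is right multiplication by `d`. -/
local notation "rm" => ContinuousLinearMap.flip (ContinuousLinearMap.mul 𝕜 A)

local notation "iA" => ContinuousLinearMap.id 𝕜 A

variable (hA : HasBoundedApproximateIdentity A)
include hA

theorem toM_mapT_lm (d : A) (z : CTensor 𝕜 A A) :
    toM (mapT (lm d) iA z) = tensorM (toM d) 1 * toM z :=
  toM_fst_apply (nondegenerate_ctensor hA) (tensorM (toM d) 1) z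

theorem toM_mapT_rm (d : A) (z : CTensor 𝕜 A A) :
    toM (mapT (rm d) iA z) = toM z * tensorM (toM d) 1 :=
  toM_snd_apply (nondegenerate_ctensor hA) (tensorM (toM d) 1) z

theorem toM_mapT_id_lm (d : A) (z : CTensor 𝕜 A A) :
    toM (mapT iA (lm d) z) = tensorM 1 (toM d) * toM z :=
  toM_fst_apply (nondegenerate_ctensor hA) (tensorM 1 (toM d)) z

theorem toM_mapT_id_rm (d : A) (z : CTensor 𝕜 A A) :
    toM (mapT iA (rm d) z) = toM z * tensorM 1 (toM d) :=
  toM_snd_apply (nondegenerate_ctensor hA) (tensorM 1 (toM d)) z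

omit hA in
theorem tensorM_one_mul_comm (m n : 𝓜(𝕜, A)) :
    tensorM 1 n * tensorM m 1 = tensorM m 1 * tensorM 1 n := by
  simp [← tensorM_mul]

/-- This and the identities that follow are associativity in M(A ⊗ A). They allow passing between
the maps Tᵢ at the cost of an auxiliary factor, which nondegeneracy later removes. -/
theorem T₃_tmul_mul (a b c : A) :
    H.T₃ (tmul a (c * b)) = mapT iA (lm c) (H.T₃ (tmul a b)) := by
  refine toM_injective (𝕜 := 𝕜) (nondegenerate_ctensor hA) ?_
  rw [toM_mapT_id_lm hA, H.T₃_spec, H.T₃_spec, ← mul_assoc, ← tensorM_mul, toM_mul, one_mul]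

theorem lm_T₁_eq (a b c : A) :
    mapT iA (lm c) (H.T₁ (tmul a b)) = mapT iA (rm b) (H.T₃ (tmul a c)) := by
  refine toM_injective (𝕜 := 𝕜) (nondegenerate_ctensor hA) ?_
  rw [toM_mapT_id_rm hA, toM_mapT_id_lm hA, H.T₁_spec, H.T₃_spec, mul_assoc]

theorem lm_T₁_eq_T₂ (a b c : A) :
    mapT (lm c) iA (H.T₁ (tmul a b)) = mapT iA (rm b) (H.T₂ (tmul c a)) := by
  refine toM_injective (𝕜 := 𝕜) (nondegenerate_ctensor hA) ?_
  rw [toM_mapT_id_rm hA, toM_mapT_lm hA, H.T₁_spec, H.T₂_spec, mul_assoc]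

theorem rm_T₁_eq_T₄ (a b c : A) :
    mapT (rm c) iA (H.T₁ (tmul a b)) = mapT iA (rm b) (H.T₄ (tmul c a)) := by
  refine toM_injective (𝕜 := 𝕜) (nondegenerate_ctensor hA) ?_
  rw [toM_mapT_id_rm hA, toM_mapT_rm hA, H.T₁_spec, H.T₄_spec, mul_assoc, mul_assoc,
    tensorM_one_mul_comm]

theorem rm_T₃_eq_T₄ (a b c : A) :
    mapT (rm c) iA (H.T₃ (tmul a b)) = mapT iA (lm b) (H.T₄ (tmul c a)) := by
  refine toM_injective (𝕜 := 𝕜) (nondegenerate_ctensor hA) ?_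
  rw [toM_mapT_id_lm hA, toM_mapT_rm hA, H.T₃_spec, H.T₄_spec, mul_assoc]

theorem lm_T₄_eq_T₂ (a b c : A) :
    mapT (lm c) iA (H.T₄ (tmul b a)) = mapT (rm b) iA (H.T₂ (tmul c a)) := by
  refine toM_injective (𝕜 := 𝕜) (nondegenerate_ctensor hA) ?_
  rw [toM_mapT_lm hA, toM_mapT_rm hA, H.T₄_spec, H.T₂_spec, mul_assoc]

theorem Δ_fst_T₁ (a b c : A) : (H.Δ a).fst (H.T₁ (tmul b c)) = H.T₁ (tmul (a * b) c) := by
  refine toM_injective (𝕜 := 𝕜) (nondegenerate_ctensor hA) ?_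
  rw [toM_fst_apply (nondegenerate_ctensor hA), H.T₁_spec, H.T₁_spec, H.map_mul, mul_assoc]

theorem Δ_fst_T₄ (a b c : A) : (H.Δ a).fst (H.T₄ (tmul c b)) = H.T₄ (tmul c (a * b)) := by
  refine toM_injective (𝕜 := 𝕜) (nondegenerate_ctensor hA) ?_
  rw [toM_fst_apply (nondegenerate_ctensor hA), H.T₄_spec, H.T₄_spec, H.map_mul, mul_assoc]

theorem Δ_fst_tmul (a p q : A) :
    (H.Δ a).fst (tmul p q) = mapT (rm p) iA (H.T₁ (tmul a q)) := by
  refine toM_injective (𝕜 := 𝕜) (nondegenerate_ctensor hA) ?_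
  rw [toM_fst_apply (nondegenerate_ctensor hA), toM_mapT_rm hA, H.T₁_spec, mul_assoc, toM_tmul,
    ← tensorM_mul, one_mul, mul_one]

variable [IsUltrametricDist A] [CompleteSpace A]

omit hA in
@[simp] theorem mulMap_tmul (a b : A) : mulMap (tmul a b : CTensor 𝕜 A A) = a * b := by
  simp [mulMap]

/-- At z = T₁(a ⊗ w), coassociativity produces (id ⊗ T₁(· ⊗ w))T₂(d ⊗ a); T₁⁻¹ cancels and only
multiplication by w remains. -/
theorem mapT_mulMap_T₁inv (d : A) (z : CTensor 𝕜 A A) :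
    mapT iA (mulMap.comp H.T₁inv) (assocT 𝕜 A A A (mapT (H.T₂R d) iA z)) =
      mapT (lm d) iA z := by
  obtain ⟨z, rfl⟩ := H.T₁.surjective z
  refine CTensor.congr_clm ((mapT iA (mulMap.comp H.T₁inv)).comp
    ((assocT 𝕜 A A A).comp ((mapT (H.T₂R d) iA).comp H.T₁L))) ((mapT (lm d) iA).comp H.T₁L)
    (fun a w => ?_) z
  simp only [ContinuousLinearMap.comp_apply, T₁L_apply]
  rw [H.coassoc_T₂_T₁ hA, mapT_mapT, H.lm_T₁_eq_T₂ hA]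
  congr 2
  ext x
  simp

/-- Since the second leg on the right is `c` itself, m T₁⁻¹(a ⊗ c) must be a multiple of c with a
factor independent of c. This is why the counit is scalar valued. -/
theorem mapT_mulMap_T₁inv_eq_tmul (c : A) (t : CTensor 𝕜 A A) :
    mapT iA ((mulMap.comp H.T₁inv).comp ((tmulL (𝕜 := 𝕜) (E := A) (F := A)).flip c)) t =
      tmul (mulMap (H.T₂.symm t)) c := by
  obtain ⟨z, rfl⟩ := H.T₂.surjective t
  rw [H.T₂.symm_apply_apply]
  refine CTensor.congr_clm
    ((mapT iA ((mulMap.comp H.T₁inv).comp ((tmulL (𝕜 := 𝕜) (E := A) (F := A)).flip c))).comp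
      H.T₂L)
    (((tmulL (𝕜 := 𝕜) (E := A) (F := A)).flip c).comp mulMap) (fun d b => ?_) z
  have h := H.mapT_mulMap_T₁inv hA d (tmul b c)
  rw [mapT_tmul, ContinuousLinearMap.id_apply, mapT_id_assocT_tmul] at h
  simpa using h

variable {f : A →L[𝕜] 𝕜} {e : A} (hf : f e = 1)
include hf

theorem counit_smul (a b : A) : H.counit a • b = mulMap (H.T₁.symm (tmul a b)) := by
  have h : ∃ ε : A →L[𝕜] 𝕜, ∀ a b, ε a • b = mulMap (H.T₁.symm (tmul a b)) := by
    -- Applying f ⊗ id to the preceding lemma at t = e ⊗ a identifies the factor as f(m T₂⁻¹(e ⊗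
    -- a)).
    refine ⟨f.comp (mulMap.comp ((H.T₂.symm.toContinuousLinearEquiv :
      CTensor 𝕜 A A →L[𝕜] CTensor 𝕜 A A).comp (tmulL e))), fun a b => ?_⟩
    have h := congrArg (sliceLeft f) (H.mapT_mulMap_T₁inv_eq_tmul hA b (tmul e a))
    simp only [mapT_tmul, sliceLeft_tmul] at h
    simpa [hf] using h.symm
  rw [counit, dif_pos h]
  exact h.choose_spec a b

theorem sliceLeft_counit (z : CTensor 𝕜 A A) :
    sliceLeft H.counit z = mulMap (H.T₁.symm z) :=
  CTensor.congr_clm (sliceLeft H.counit) (mulMap.comp H.T₁inv)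
    (fun a b => by simp [H.counit_smul hA hf]) z

theorem sliceRight_counit (z : CTensor 𝕜 A A) :
    sliceRight H.counit z = mulMap (H.T₂.symm z) := by
  refine CTensor.congr_clm (sliceRight H.counit) (mulMap.comp (H.T₂.symm.toContinuousLinearEquiv :
      CTensor 𝕜 A A →L[𝕜] CTensor 𝕜 A A)) (fun x y => ?_) z
  have h := congrArg (sliceRight f) (H.mapT_mulMap_T₁inv_eq_tmul hA e (tmul x y))
  simp only [mapT_tmul, sliceRight_tmul] at h
  simpa [hf, ← H.counit_smul hA hf] using h

theorem sliceRight_counit_T₄ (c a : A) : sliceRight H.counit (H.T₄ (tmul c a)) = a * c := by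
  rw [← sub_eq_zero]
  refine hA.nondegenerateProduct.2 _ fun d => ?_
  have h := congrArg (sliceRight H.counit) (H.lm_T₄_eq_T₂ hA a c d)
  simp only [sliceRight_mapT, ContinuousLinearMap.comp_id] at h
  rw [H.sliceRight_counit hA hf (H.T₂ _), H.T₂.symm_apply_apply] at h
  rw [mul_sub, sub_eq_zero]
  simpa [mul_assoc] using h

theorem sliceLeft_counit_Δ_fst (a : A) (z : CTensor 𝕜 A A) :
    sliceLeft H.counit ((H.Δ a).fst z) = a * sliceLeft H.counit z := by
  obtain ⟨z, rfl⟩ := H.T₁.surjective z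
  refine CTensor.congr_clm ((sliceLeft H.counit).comp ((H.Δ a).fst.comp H.T₁L))
    ((lm a).comp ((sliceLeft H.counit).comp H.T₁L)) (fun x y => ?_) z
  simp [H.Δ_fst_T₁ hA, H.sliceLeft_counit hA hf, mul_assoc]

/-- From (ε ⊗ id)(Δ(x)(b ⊗ y)) = ε(b)xy, slicing T₁(x ⊗ y) by ε(· b) or by ε(b)ε gives the same
result. As T₁ is onto, the two functionals agree. -/
theorem counit_mul (a b : A) : H.counit (a * b) = H.counit a * H.counit b := by
  have h : ∀ z, sliceLeft (F := A) (H.counit.comp (rm b)) z =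
      H.counit b • sliceLeft H.counit z := fun z => by
    obtain ⟨z, rfl⟩ := H.T₁.surjective z
    refine CTensor.congr_clm ((sliceLeft (H.counit.comp (rm b))).comp H.T₁L)
      (H.counit b • (sliceLeft H.counit).comp H.T₁L) (fun x y => ?_) z
    have h := H.sliceLeft_counit_Δ_fst hA hf x (tmul b y)
    rw [H.Δ_fst_tmul hA, sliceLeft_mapT] at h
    simpa [H.sliceLeft_counit hA hf (H.T₁ _), mul_smul_comm] using h
  have h' := congrArg f (h (tmul a e))
  simpa [hf, mul_comm] using h'

theorem exists_counit_eq_one : ∃ a, H.counit a = 1 := by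
  have : ∃ a, H.counit a ≠ 0 := by
    by_contra! h
    have h0 : sliceLeft (F := A) H.counit = 0 := CTensor.ext_clm fun x y => by simp [h]
    have he : e = 0 := hA.nondegenerateProduct.1 _ fun b => by
      have := H.sliceLeft_counit hA hf (H.T₁ (tmul e b))
      simpa [h0] using this.symm
    simp [he] at hf
  obtain ⟨a, ha⟩ := this
  exact ⟨(H.counit a)⁻¹ • a, by simp [ha]⟩

theorem sliceRight_counit_T₁ (b a : A) :
    sliceRight H.counit (H.T₁ (tmul b a)) = H.counit a • b := by
  rw [← sub_eq_zero]
  refine hA.nondegenerateProduct.2 _ fun d => ?_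
  have h := congrArg (sliceRight H.counit) (H.lm_T₁_eq_T₂ hA b a d)
  have h1 : H.counit.comp (rm a) = H.counit a • H.counit := by
    ext x; simp [H.counit_mul hA hf, mul_comm]
  have h2 : sliceRight (H.counit a • H.counit) (H.T₂ (tmul d b)) =
      H.counit a • sliceRight (E := A) H.counit (H.T₂ (tmul d b)) :=
    CTensor.congr_clm (sliceRight (E := A) (H.counit a • H.counit))
      (H.counit a • sliceRight (E := A) H.counit) (fun x y => by simp [smul_smul]) _
  simp only [sliceRight_mapT, ContinuousLinearMap.comp_id] at h
  rw [h1, h2, H.sliceRight_counit hA hf (H.T₂ _), H.T₂.symm_apply_apply] at h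
  rw [mul_sub, sub_eq_zero]
  simpa [mul_smul_comm] using h

end MultiplierBanachHopf

/-! ### Slices of triple tensors -/

section Slices

variable {𝕜 E F G F' E' : Type*} [NontriviallyNormedField 𝕜]
  [NormedAddCommGroup E] [NormedSpace 𝕜 E] [NormedAddCommGroup F] [NormedSpace 𝕜 F]
  [NormedAddCommGroup E'] [NormedSpace 𝕜 E']
  [NormedAddCommGroup F'] [NormedSpace 𝕜 F'] [NormedAddCommGroup G] [NormedSpace 𝕜 G]

@[simp]
theorem swapT_swapT (z : CTensor 𝕜 E F) : swapT (swapT z) = z :=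
  CTensor.congr_clm (swapT.comp swapT) (.id 𝕜 _) (fun x y => by simp) z

theorem mapT_comp_id (f : E →L[𝕜] F) (g : F →L[𝕜] G) (z : CTensor 𝕜 E E') :
    mapT (g.comp f) (.id 𝕜 E') z = mapT g (.id 𝕜 E') (mapT f (.id 𝕜 E') z) := by
  rw [mapT_mapT]; rfl

theorem mapT_id_comp (f : E →L[𝕜] F) (g : F →L[𝕜] G) (z : CTensor 𝕜 E' E) :
    mapT (.id 𝕜 E') (g.comp f) z = mapT (.id 𝕜 E') g (mapT (.id 𝕜 E') f z) := by
  rw [mapT_mapT]; rfl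

theorem mapT_id_comm (f : E →L[𝕜] F) (g : E' →L[𝕜] F') (z : CTensor 𝕜 E E') :
    mapT f (.id 𝕜 F') (mapT (.id 𝕜 E) g z) = mapT (.id 𝕜 F) g (mapT f (.id 𝕜 E') z) := by
  rw [mapT_mapT, mapT_mapT]; rfl

theorem sliceLeft_swapT [CompleteSpace E] [IsUltrametricDist E] (ω : F →L[𝕜] 𝕜)
    (z : CTensor 𝕜 E F) : sliceLeft ω (swapT z) = sliceRight ω z :=
  CTensor.congr_clm ((sliceLeft ω).comp swapT) (sliceRight ω) (fun x y => by simp) z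

theorem mapT_id_smulRight [CompleteSpace E] [IsUltrametricDist E] (ω : F →L[𝕜] 𝕜) (c : G)
    (z : CTensor 𝕜 E F) : mapT (.id 𝕜 E) (ω.smulRight c) z = tmul (sliceRight ω z) c :=
  CTensor.congr_clm (mapT (.id 𝕜 E) (ω.smulRight c))
    (((tmulL (𝕜 := 𝕜) (E := E) (F := G)).flip c).comp (sliceRight ω)) (fun x y => by simp) z

theorem mapT_id_sliceRight_assocT [CompleteSpace F] [IsUltrametricDist F] (ω : G →L[𝕜] 𝕜)
    (z : CTensor 𝕜 (CTensor 𝕜 E F) G) :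
    mapT (.id 𝕜 E) (sliceRight ω) (assocT 𝕜 E F G z) = sliceRight ω z :=
  CTensor.congr_clm_left ((mapT (.id 𝕜 E) (sliceRight ω)).comp (assocT 𝕜 E F G)) (sliceRight ω)
    (fun x y z => by simp) z

theorem sliceRight_comp_sliceRight_assocT [CompleteSpace E] [IsUltrametricDist E]
    [CompleteSpace F] [IsUltrametricDist F] (ω : F →L[𝕜] 𝕜) (η : G →L[𝕜] 𝕜)
    (z : CTensor 𝕜 (CTensor 𝕜 E F) G) :
    sliceRight (ω.comp (sliceRight η)) (assocT 𝕜 E F G z) = sliceRight ω (sliceRight η z) :=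
  CTensor.congr_clm_left ((sliceRight (ω.comp (sliceRight η))).comp (assocT 𝕜 E F G))
    ((sliceRight ω).comp (sliceRight η)) (fun x y z => by simp [mul_smul]) z

theorem mapT_assocT_id (f : E →L[𝕜] E') (z : CTensor 𝕜 (CTensor 𝕜 E F) G) :
    mapT f (.id 𝕜 (CTensor 𝕜 F G)) (assocT 𝕜 E F G z) =
      assocT 𝕜 E' F G (mapT (mapT f (.id 𝕜 F)) (.id 𝕜 G) z) :=
  CTensor.congr_clm_left ((mapT f (.id 𝕜 (CTensor 𝕜 F G))).comp (assocT 𝕜 E F G))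
    ((assocT 𝕜 E' F G).comp (mapT (mapT f (.id 𝕜 F)) (.id 𝕜 G))) (fun x y z => by simp) z

theorem mapT_id_mapT_assocT (f : F →L[𝕜] F') (z : CTensor 𝕜 (CTensor 𝕜 E F) G) :
    mapT (.id 𝕜 E) (mapT f (.id 𝕜 G)) (assocT 𝕜 E F G z) =
      assocT 𝕜 E F' G (mapT (mapT (.id 𝕜 E) f) (.id 𝕜 G) z) :=
  CTensor.congr_clm_left ((mapT (.id 𝕜 E) (mapT f (.id 𝕜 G))).comp (assocT 𝕜 E F G))
    ((assocT 𝕜 E F' G).comp (mapT (mapT (.id 𝕜 E) f) (.id 𝕜 G))) (fun x y z => by simp) z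

end Slices

/-- The left action of multipliers as a continuous linear map. -/
def fstL {𝕜 A : Type*} [NontriviallyNormedField 𝕜]
    [NonUnitalNormedRing A] [NormedSpace 𝕜 A] [SMulCommClass 𝕜 A A] [IsScalarTower 𝕜 A A] :
    𝓜(𝕜, A) →L[𝕜] A →L[𝕜] A :=
  LinearMap.mkContinuous
    { toFun := fun m => m.fst
      map_add' := fun _ _ => rfl
      map_smul' := fun _ _ => rfl } 1 fun m => by
    rw [one_mul]
    exact le_max_left _ _

@[simp]
theorem fstL_apply {𝕜 A : Type*} [NontriviallyNormedField 𝕜]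
    [NonUnitalNormedRing A] [NormedSpace 𝕜 A] [SMulCommClass 𝕜 A A] [IsScalarTower 𝕜 A A]
    (m : 𝓜(𝕜, A)) : fstL m = m.fst := rfl

/-! ### The antipode and strong left invariance -/

namespace MultiplierBanachHopf

variable {𝕜 A : Type*} [NontriviallyNormedField 𝕜]
  [NonUnitalNormedRing A] [NormedSpace 𝕜 A] [SMulCommClass 𝕜 A A] [IsScalarTower 𝕜 A A]
  (H : MultiplierBanachHopf 𝕜 A)

/-- `lm d` is left multiplication by `d`. -/
local notation "lm" => ContinuousLinearMap.mul 𝕜 A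
/-- `rm d` is right multiplication by `d`. -/
local notation "rm" => ContinuousLinearMap.flip (ContinuousLinearMap.mul 𝕜 A)

local notation "iA" => ContinuousLinearMap.id 𝕜 A

/-- `b ↦ (a ↦ T₁(a ⊗ b))` as a continuous linear map. -/
def T₁RL : A →L[𝕜] A →L[𝕜] CTensor 𝕜 A A :=
  (ContinuousLinearMap.compL 𝕜 A (CTensor 𝕜 A A) (CTensor 𝕜 A A) H.T₁L).comp
    (tmulL (𝕜 := 𝕜) (E := A) (F := A)).flip

@[simp] theorem T₁RL_apply (b : A) : H.T₁RL b = H.T₁R b := rfl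

/-- The map `u ⊗ v ↦ T₁₂T₁₃(a ⊗ u ⊗ v)`. -/
def doubleT₁ (a : A) : CTensor 𝕜 A A →L[𝕜] CTensor 𝕜 A (CTensor 𝕜 A A) :=
  (assocT 𝕜 A A A).comp
    (lift (((mapTL.flip iA).comp H.T₁RL).bilinearComp iA (H.T₁L.comp (tmulL a))))

@[simp]
theorem doubleT₁_tmul (a u v : A) : H.doubleT₁ a (tmul u v) =
    assocT 𝕜 A A A (mapT (H.T₁R u) iA (H.T₁ (tmul a v))) := by
  simp [doubleT₁]

/-- `w ↦ (a ↦ Δ(a)w)`. -/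
def ΔR : CTensor 𝕜 A A →L[𝕜] A →L[𝕜] CTensor 𝕜 A A := (fstL.comp H.Δ).flip

@[simp] theorem ΔR_apply (w : CTensor 𝕜 A A) (a : A) : H.ΔR w a = (H.Δ a).fst w := rfl

variable (hA : HasBoundedApproximateIdentity A)
include hA

/-- `doubleT₁ a w` plays the role of Δ²(a)(1 ⊗ w). The factor `d` brings (d ⊗ 1)Δ(a) into A ⊗ A,
where id ⊗ Δ(·)w can be applied. -/
theorem mapT_lm_doubleT₁ (d a : A) (w : CTensor 𝕜 A A) :
    mapT (lm d) (.id 𝕜 _) (H.doubleT₁ a w) = mapT iA (H.ΔR w) (H.T₂ (tmul d a)) := by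
  refine CTensor.congr_clm ((mapT (lm d) (.id 𝕜 _)).comp (H.doubleT₁ a))
    (((mapTL iA).comp H.ΔR).flip (H.T₂ (tmul d a))) (fun u v => ?_) w
  have h1 : (mapT (lm d) iA).comp (H.T₁R u) = (mapT iA (rm u)).comp (H.T₂R d) :=
    ContinuousLinearMap.ext fun x => H.lm_T₁_eq_T₂ hA x u d
  have h2 : (mapT (rm u) iA).comp (H.T₁R v) = H.ΔR (tmul u v) :=
    ContinuousLinearMap.ext fun x => (H.Δ_fst_tmul hA x u v).symm
  simp only [ContinuousLinearMap.comp_apply, ContinuousLinearMap.flip_apply, mapTL_apply,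
    doubleT₁_tmul]
  rw [mapT_assocT_id, ← mapT_comp_id, h1, ← h2, mapT_id_comp, ← H.coassoc_T₂_T₁ hA,
    mapT_id_mapT_assocT, mapT_comp_id]

/-- Both sides are Δ²(a)(1 ⊗ Δ(b)(c ⊗ 1)), with Δ² read as (id ⊗ Δ)Δ on the left and as (Δ ⊗ id)Δ on
the right. -/
theorem pentagon (a b c : A) :
    mapT iA (H.T₄R c) (H.T₁ (tmul a b)) = H.doubleT₁ a (H.T₄ (tmul c b)) := by
  refine hA.eq_of_mapT_mul fun d => ?_
  have h1 : H.ΔR (H.T₄ (tmul c b)) = (H.T₄R c).comp (rm b) :=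
    ContinuousLinearMap.ext fun x => H.Δ_fst_T₄ hA x b c
  rw [H.mapT_lm_doubleT₁ hA, h1, mapT_id_comp, ← H.lm_T₁_eq_T₂ hA, mapT_id_comm]

variable [IsUltrametricDist A] [CompleteSpace A]

omit hA in
theorem mapT_sliceRight_doubleT₁ (ω : A →L[𝕜] 𝕜) (a : A) (w : CTensor 𝕜 A A) :
    mapT iA (sliceRight ω) (H.doubleT₁ a w) =
      H.T₁ (swapT (mapT iA ((sliceRight ω).comp (H.T₁L.comp (tmulL a))) w)) :=
  CTensor.congr_clm ((mapT iA (sliceRight ω)).comp (H.doubleT₁ a))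
    (H.T₁L.comp (swapT.comp (mapT iA ((sliceRight ω).comp (H.T₁L.comp (tmulL a))))))
    (fun u v => by
      simp [mapT_id_sliceRight_assocT, sliceRight_mapT]) w

variable {φ : A →L[𝕜] 𝕜} (hφ : ∀ a b, sliceRight φ (H.T₄ (tmul b a)) = φ a • b)
include hφ

/-- Apply id ⊗ id ⊗ φ to `pentagon`: on one side invariance collapses Δ(x)(c ⊗ 1) to φ(x)c, and the
other side is T₁ of an explicit tensor. -/
theorem T₁_symm_sliceRight_T₁ (a b c : A) :
    H.T₁.symm (tmul (sliceRight φ (H.T₁ (tmul a b))) c) =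
      swapT (mapT iA ((sliceRight φ).comp (H.T₁L.comp (tmulL a))) (H.T₄ (tmul c b))) := by
  have h1 : (sliceRight φ).comp (H.T₄R c) = φ.smulRight c :=
    ContinuousLinearMap.ext fun x => hφ x c
  rw [LinearIsometryEquiv.symm_apply_eq, ← mapT_sliceRight_doubleT₁, ← H.pentagon hA, mapT_mapT,
    h1, ← mapT_id_smulRight]
  rfl

/-- The functional x ↦ (φ ⊗ φ)((1 ⊗ a)Δ(x)) satisfies left invariance again, by slicing the last two
legs of `coassoc_T₄_T₃` with φ. -/
theorem sliceRight_T₃_functional (a b c : A) :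
    sliceRight (φ.comp ((sliceRight φ).comp (H.T₃R a))) (H.T₄ (tmul c b)) =
      φ (sliceRight φ (H.T₃ (tmul b a))) • c := by
  have h := congrArg (sliceRight (φ.comp (sliceRight φ))) (H.coassoc_T₄_T₃ hA c b a)
  rw [sliceRight_comp_sliceRight_assocT, sliceRight_mapT, sliceRight_mapT] at h
  simp only [ContinuousLinearMap.comp_id, T₄R_apply, hφ] at h
  exact h.symm

variable {e : A} (hf : φ e = 1)
include hf

/-- Strong left invariance multiplied by c, in a form that does not presuppose the existence of S.
The counit enters through (ε ⊗ id)T₁(a ⊗ x) = ax. -/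
theorem sliceLeft_counit_sliceRight (z : CTensor 𝕜 A A) (c : A) :
    sliceLeft H.counit (H.T₁.symm (tmul (sliceRight φ (H.T₁ z)) c)) =
      sliceRight φ (H.T₃ (swapT z)) * c := by
  refine CTensor.congr_clm ((sliceLeft H.counit).comp (H.T₁inv.comp
    (((tmulL (𝕜 := 𝕜) (E := A) (F := A)).flip c).comp ((sliceRight φ).comp H.T₁L))))
    ((rm c).comp ((sliceRight φ).comp (H.T₃L.comp swapT))) (fun a b => ?_) z
  simp only [ContinuousLinearMap.comp_apply, ContinuousLinearMap.flip_apply, T₁L_apply,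
    T₁inv_apply, T₃L_apply, swapT_tmul, ContinuousLinearMap.mul_apply']
  have h1 : H.counit.comp ((sliceRight φ).comp (H.T₁L.comp (tmulL a))) = φ.comp (lm a) :=
    ContinuousLinearMap.ext fun x => by
      simp [← apply_sliceLeft_eq, H.sliceLeft_counit hA hf]
  rw [H.T₁_symm_sliceRight_T₁ hA hφ, sliceLeft_swapT, sliceRight_mapT, h1]
  have h2 := congrArg (sliceRight φ) (H.rm_T₃_eq_T₄ hA b a c)
  rw [sliceRight_mapT, sliceRight_mapT] at h2
  exact h2.symm

theorem antipode_mul (a b : A) :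
    H.antipode a * b = sliceLeft H.counit (H.T₁.symm (tmul a b)) := by
  have h : ∃ S : A →L[𝕜] A, ∀ a b, S a * b = sliceLeft H.counit (H.T₁.symm (tmul a b)) := by
    -- Since φ(e) = 1, (id ⊗ φ)T₁ sends T₁⁻¹(a ⊗ e) to a, so strong invariance dictates the value of
    -- S(a).
    refine ⟨(sliceRight φ).comp (H.T₃L.comp (swapT.comp (H.T₁inv.comp (tmulL.flip e)))),
      fun a b => ?_⟩
    have := H.sliceLeft_counit_sliceRight hA hφ hf (H.T₁.symm (tmul a e)) b
    rw [H.T₁.apply_symm_apply, sliceRight_tmul, hf, one_smul] at this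
    exact this.symm
  rw [antipode, dif_pos h]
  exact h.choose_spec a b

theorem antipode_sliceRight (z : CTensor 𝕜 A A) :
    H.antipode (sliceRight φ (H.T₁ z)) = sliceRight φ (H.T₃ (swapT z)) := by
  rw [← sub_eq_zero]
  refine hA.nondegenerateProduct.1 _ fun c => ?_
  rw [sub_mul, sub_eq_zero, H.antipode_mul hA hφ hf, H.sliceLeft_counit_sliceRight hA hφ hf]

theorem antipode_surjective : Function.Surjective H.antipode := fun y =>
  ⟨sliceRight φ (H.T₁ (swapT (H.T₃.symm (tmul y e)))), by
    rw [H.antipode_sliceRight hA hφ hf, swapT_swapT, H.T₃.apply_symm_apply, sliceRight_tmul, hf,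
      one_smul]⟩

/-- `φ ∘ S` is right invariant. -/
theorem sliceLeft_comp_antipode_T₁ (z : CTensor 𝕜 A A) :
    sliceLeft (φ.comp H.antipode) (H.T₁ z) = sliceLeft (φ.comp H.antipode) z := by
  set ψ := φ.comp H.antipode with hψ
  have h1 : ∀ z c, sliceLeft ψ (H.T₁.symm (tmul (sliceRight φ (H.T₁ z)) c)) =
      ψ (sliceRight φ (H.T₁ z)) • c := fun z c => by
    refine CTensor.congr_clm ((sliceLeft ψ).comp (H.T₁inv.comp
      (((tmulL (𝕜 := 𝕜) (E := A) (F := A)).flip c).comp ((sliceRight φ).comp H.T₁L))))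
      ((ψ.smulRight c).comp ((sliceRight φ).comp H.T₁L)) (fun a b => ?_) z
    simp only [ContinuousLinearMap.comp_apply, ContinuousLinearMap.flip_apply, T₁L_apply,
      T₁inv_apply, ContinuousLinearMap.smulRight_apply]
    -- Strong invariance identifies this functional with x ↦ (φ ⊗ φ)((1 ⊗ a)Δ(x)), to which
    -- `sliceRight_T₃_functional` applies.
    have h2 : ψ.comp ((sliceRight φ).comp (H.T₁L.comp (tmulL a))) =
        φ.comp ((sliceRight φ).comp (H.T₃R a)) :=
      ContinuousLinearMap.ext fun x => by
        simp [hψ, H.antipode_sliceRight hA hφ hf]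
    rw [H.T₁_symm_sliceRight_T₁ hA hφ, sliceLeft_swapT, sliceRight_mapT, h2,
      H.sliceRight_T₃_functional hA hφ]
    simp [hψ, H.antipode_sliceRight hA hφ hf]
  have h2 : ∀ w, sliceLeft (F := A) ψ (H.T₁.symm w) = sliceLeft ψ w := fun w => by
    refine CTensor.congr_clm ((sliceLeft ψ).comp H.T₁inv) (sliceLeft ψ) (fun x c => ?_) w
    have := h1 (H.T₁.symm (tmul x e)) c
    rw [H.T₁.apply_symm_apply, sliceRight_tmul, hf, one_smul] at this
    simpa using this
  rw [← h2, H.T₁.symm_apply_apply]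

/-- Strong invariance rewrites (φ ⊗ φ)((1 ⊗ a)Δ(b)) as (φ ∘ S ⊗ φ)(Δ(a)(1 ⊗ b)), and right
invariance of φ ∘ S evaluates the latter. -/
theorem apply_sliceLeft_T₃ (a b : A) :
    φ (sliceLeft φ (H.T₃ (tmul b a))) = φ (H.antipode a) * φ b := by
  have h := H.antipode_sliceRight hA hφ hf (tmul a b)
  rw [swapT_tmul] at h
  rw [apply_sliceLeft_eq, ← h]
  have h1 := apply_sliceLeft_eq (φ.comp H.antipode) φ (H.T₁ (tmul a b))
  rw [H.sliceLeft_comp_antipode_T₁ hA hφ hf] at h1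
  simpa using h1.symm

end MultiplierBanachHopf

/-! ### Separation by functionals and completeness of the scalars -/

section Slices

variable {𝕜 E F G : Type*} [NontriviallyNormedField 𝕜]
  [NormedAddCommGroup E] [NormedSpace 𝕜 E] [NormedAddCommGroup F] [NormedSpace 𝕜 F]
  [NormedAddCommGroup G] [NormedSpace 𝕜 G]

theorem mapT_smulRight_id [CompleteSpace F] [IsUltrametricDist F] (ω : E →L[𝕜] 𝕜) (c : G)
    (z : CTensor 𝕜 E F) : mapT (ω.smulRight c) (.id 𝕜 F) z = tmul c (sliceLeft ω z) :=
  CTensor.congr_clm (mapT (ω.smulRight c) (.id 𝕜 F))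
    ((tmulL (𝕜 := 𝕜) (E := G) (F := F) c).comp (sliceLeft ω))
    (fun x y => by simp [ContinuousLinearMap.map_smul₂]) z

theorem sliceLeft_assocT [CompleteSpace F] [IsUltrametricDist F] (ω : E →L[𝕜] 𝕜)
    (z : CTensor 𝕜 (CTensor 𝕜 E F) G) :
    sliceLeft ω (assocT 𝕜 E F G z) = mapT (sliceLeft ω) (.id 𝕜 G) z :=
  CTensor.congr_clm_left ((sliceLeft ω).comp (assocT 𝕜 E F G)) (mapT (sliceLeft ω) (.id 𝕜 G))
    (fun x y z => by simp [ContinuousLinearMap.map_smul₂]) z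

@[simp]
theorem sliceRight_zero [CompleteSpace E] [IsUltrametricDist E] (z : CTensor 𝕜 E F) :
    sliceRight (0 : F →L[𝕜] 𝕜) z = 0 :=
  CTensor.congr_clm (sliceRight (0 : F →L[𝕜] 𝕜)) 0 (fun x y => by simp) z

/-- Rescaling a nonzero vector to norm above 1 lets polarity supply a functional that does not
vanish on it. -/
theorem IsPolar.eq_zero (h : IsPolar 𝕜 E) {x : E} (hx : ∀ f : E →L[𝕜] 𝕜, f x = 0) : x = 0 := by
  by_contra hne
  have h0 : 0 < ‖x‖ := norm_pos_iff.2 hne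
  obtain ⟨k, hk⟩ := NormedField.exists_lt_norm 𝕜 (1 / ‖x‖)
  obtain ⟨f, -, hf⟩ := h (k • x) (by rwa [norm_smul, ← div_lt_iff₀ h0])
  rw [map_smul, hx, smul_zero, norm_zero] at hf
  linarith

/-- The map k ↦ k • e into the complete space has the continuous left inverse `f`. Completeness of 𝕜
is needed for the orthogonal families. -/
theorem completeSpace_of_apply_eq_one [CompleteSpace E] {f : E →L[𝕜] 𝕜} {e : E} (hf : f e = 1) :
    CompleteSpace 𝕜 := by
  refine Metric.complete_of_cauchySeq_tendsto fun u hu => ?_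
  have h := ((ContinuousLinearMap.id 𝕜 𝕜).smulRight e).uniformContinuous.comp_cauchySeq hu
  obtain ⟨x, hx⟩ := cauchySeq_tendsto_of_complete h
  refine ⟨f x, ?_⟩
  have := (f.continuous.tendsto x).comp hx
  simpa [Function.comp_def, hf] using this

end Slices

/-! ### Faithfulness and the modular element -/

namespace MultiplierBanachHopf

variable {𝕜 A : Type*} [NontriviallyNormedField 𝕜]
  [NonUnitalNormedRing A] [NormedSpace 𝕜 A] [SMulCommClass 𝕜 A A] [IsScalarTower 𝕜 A A]
  (H : MultiplierBanachHopf 𝕜 A)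

/-- `lm d` is left multiplication by `d`. -/
local notation "lm" => ContinuousLinearMap.mul 𝕜 A
/-- `rm d` is right multiplication by `d`. -/
local notation "rm" => ContinuousLinearMap.flip (ContinuousLinearMap.mul 𝕜 A)

local notation "iA" => ContinuousLinearMap.id 𝕜 A

variable (hA : HasBoundedApproximateIdentity A) [IsUltrametricDist A] [CompleteSpace A]
  {φ : A →L[𝕜] 𝕜} (hφ : ∀ a b, sliceRight φ (H.T₄ (tmul b a)) = φ a • b)
  {e : A} (hf : φ e = 1)
include hA hφ hf

omit hφ in
theorem sliceLeft_counit_T₁_symm_Δ (y : A) (w : CTensor 𝕜 A A) :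
    sliceLeft H.counit (H.T₁.symm ((H.Δ y).fst w)) =
      H.counit y • sliceLeft H.counit (H.T₁.symm w) := by
  obtain ⟨z, rfl⟩ := H.T₁.surjective w
  refine CTensor.congr_clm ((sliceLeft H.counit).comp (H.T₁inv.comp ((H.Δ y).fst.comp H.T₁L)))
    (H.counit y • (sliceLeft H.counit).comp (H.T₁inv.comp H.T₁L)) (fun p q => ?_) z
  simp [H.Δ_fst_T₁ hA, H.counit_mul hA hf, mul_smul]

/-- `m (S ⊗ id)(Δ(y)(b ⊗ 1)) = ε(y) S(b)`. -/
theorem mulMap_antipode_T₄ (b y : A) :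
    mulMap (mapT H.antipode iA (H.T₄ (tmul b y))) = H.counit y • H.antipode b := by
  rw [← sub_eq_zero]
  refine hA.nondegenerateProduct.1 _ fun c => ?_
  -- The formula for S(p)qc, extended from p ⊗ q to all tensors.
  have h : ∀ t, mulMap (mapT H.antipode iA t) * c =
      sliceLeft H.counit (H.T₁.symm (mapT iA (rm c) t)) := fun t =>
    CTensor.congr_clm ((rm c).comp (mulMap.comp (mapT H.antipode iA)))
      ((sliceLeft H.counit).comp (H.T₁inv.comp (mapT iA (rm c))))
      (fun p q => by simp [← H.antipode_mul hA hφ hf, mul_assoc]) t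
  rw [sub_mul, sub_eq_zero, h, ← H.rm_T₁_eq_T₄ hA, ← H.Δ_fst_tmul hA,
    H.sliceLeft_counit_T₁_symm_Δ hA hf, ← H.antipode_mul hA hφ hf, smul_mul_assoc]

/-- The assumption kills (id ⊗ φ)(Δ(a)(1 ⊗ y)), and strong invariance carries this over to (id ⊗
φ)((1 ⊗ a)Δ(y)). -/
theorem sliceRight_T₄_eq_zero {y : A} (hy : ∀ a, φ (a * y) = 0) (a c : A) :
    sliceRight (φ.comp (lm a)) (H.T₄ (tmul c y)) = 0 := by
  have h1 : sliceRight φ (H.T₁ (tmul a y)) = 0 := by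
    refine hA.nondegenerateProduct.2 _ fun d => ?_
    have h := congrArg (sliceRight φ) (H.lm_T₁_eq_T₂ hA a y d)
    have h0 : φ.comp (rm y) = 0 := ContinuousLinearMap.ext hy
    rw [sliceRight_mapT, sliceRight_mapT, h0] at h
    simpa using h
  have h2 := H.antipode_sliceRight hA hφ hf (tmul a y)
  rw [h1, map_zero, swapT_tmul] at h2
  have h := congrArg (sliceRight φ) (H.rm_T₃_eq_T₄ hA y a c)
  rw [sliceRight_mapT, sliceRight_mapT, ContinuousLinearMap.comp_id, ← h2] at h
  simpa using h.symm

theorem counit_eq_zero [IsUltrametricDist 𝕜] {y : A} (hy : ∀ a, φ (a * y) = 0) :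
    H.counit y = 0 := by
  have := completeSpace_of_apply_eq_one hf
  -- With S(c) = e, the vanishing of φ(m(S ⊗ id)(Δ(y)(c ⊗ 1))) = ε(y)φ(S(c)) reads ε(y) = 0.
  obtain ⟨c, hc⟩ := H.antipode_surjective hA hφ hf e
  have h := lift_comp_eq_zero ((ContinuousLinearMap.compL 𝕜 A A 𝕜 φ).comp lm) H.antipode
    (H.T₄ (tmul c y)) fun a => H.sliceRight_T₄_eq_zero hA hφ hf hy a c
  have h1 : lift (((ContinuousLinearMap.compL 𝕜 A A 𝕜 φ).comp lm).comp H.antipode) =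
      φ.comp (mulMap.comp (mapT H.antipode iA)) := CTensor.ext_clm fun x y => by simp
  rw [h1] at h
  simpa [H.mulMap_antipode_T₄ hA hφ hf, hc, hf] using h

/-- A left invariant functional is faithful. -/
theorem faithful [IsUltrametricDist 𝕜] (hpolar : IsPolar 𝕜 A) {y : A}
    (hy : ∀ a, φ (a * y) = 0) : y = 0 := by
  refine hA.nondegenerateProduct.1 _ fun c => hpolar.eq_zero fun f => ?_
  -- f(yc) is the counit of (f ⊗ id)(Δ(y)(c ⊗ 1)), an element that φ(a ·) annihilates for every a,
  -- just as it does `y`.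
  rw [← H.sliceRight_counit_T₄ hA hf c y, ← apply_sliceLeft_eq]
  refine H.counit_eq_zero hA hφ hf fun a => ?_
  have := apply_sliceLeft_eq f (φ.comp (lm a)) (H.T₄ (tmul c y))
  rw [H.sliceRight_T₄_eq_zero hA hφ hf hy, map_zero] at this
  exact this

/-- δ is (φ ⊗ id)Δ(e). By `apply_sliceLeft_T₃`, φ(a · (φ ⊗ id)((1 ⊗ c)Δ(b))) = φ(S(ac))φ(b), and
faithfulness strips off φ(a ·). -/
theorem exists_modular [IsUltrametricDist 𝕜] (hpolar : IsPolar 𝕜 A) : ∃ δ : 𝓜(𝕜, A),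
    (∀ z, sliceLeft φ (H.T₁ z) = δ.fst (sliceLeft φ z)) ∧
    ∀ z, sliceLeft φ (H.T₃ z) = δ.snd (sliceLeft φ z) := by
  let δ : 𝓜(𝕜, A) := ⟨((sliceLeft φ).comp (H.T₁L.comp (tmulL e)),
    (sliceLeft φ).comp (H.T₃L.comp (tmulL e))), fun x y => by
      have h := congrArg (sliceLeft φ) (H.lm_T₁_eq hA e y x)
      rw [sliceLeft_mapT, sliceLeft_mapT] at h
      exact h.symm⟩
  have hl : ∀ a b c, a * sliceLeft φ (H.T₃ (tmul b c)) = sliceLeft φ (H.T₃ (tmul b (a * c))) :=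
    fun a b c => by
      rw [H.T₃_tmul_mul hA, sliceLeft_mapT]
      rfl
  have h3 : ∀ b c, sliceLeft φ (H.T₃ (tmul b c)) = φ b • δ.snd c := fun b c => by
    rw [← sub_eq_zero]
    refine H.faithful hA hφ hf hpolar fun a => ?_
    change φ (a * (_ - φ b • sliceLeft φ (H.T₃ (tmul e c)))) = 0
    rw [mul_sub, mul_smul_comm, hl, hl, map_sub, map_smul, H.apply_sliceLeft_T₃ hA hφ hf,
      H.apply_sliceLeft_T₃ hA hφ hf, hf]
    simp [mul_comm]
  have h1 : ∀ b d, sliceLeft φ (H.T₁ (tmul b d)) = φ b • δ.fst d := fun b d => by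
    rw [← sub_eq_zero]
    refine hA.nondegenerateProduct.2 _ fun c => ?_
    have h := congrArg (sliceLeft φ) (H.lm_T₁_eq hA b d c)
    rw [sliceLeft_mapT, sliceLeft_mapT, ContinuousLinearMap.comp_id, h3] at h
    rw [mul_sub, sub_eq_zero, mul_smul_comm, ← δ.central, ← smul_mul_assoc]
    exact h
  exact ⟨δ, fun z => CTensor.congr_clm ((sliceLeft φ).comp H.T₁L) (δ.fst.comp (sliceLeft φ))
      (fun x y => by simp [h1]) z,
    fun z => CTensor.congr_clm ((sliceLeft φ).comp H.T₃L) (δ.snd.comp (sliceLeft φ))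
      (fun x y => by simp [h3]) z⟩

/-! ### Invertibility of δ and its image under Δ, ε and S -/

variable {δ : 𝓜(𝕜, A)} (h₁ : ∀ z, sliceLeft φ (H.T₁ z) = δ.fst (sliceLeft φ z))
include h₁

omit hφ in
-- Slicing T₁⁻¹(e ⊗ y) and T₃⁻¹(e ⊗ y) by φ gives right inverses of the two actions of δ.
-- Surjectivity of the right action makes the left action injective, so the inverse is two-sided.
theorem isUnit_modular (h₃ : ∀ z, sliceLeft φ (H.T₃ z) = δ.snd (sliceLeft φ z)) :
    ∃ u : (𝓜(𝕜, A))ˣ, (u : 𝓜(𝕜, A)) = δ := by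
  have hnd := hA.nondegenerateProduct
  let κ : A →L[𝕜] A := (sliceLeft φ).comp (H.T₁inv.comp (tmulL e))
  let κ' : A →L[𝕜] A :=
    (sliceLeft φ).comp ((H.T₃.symm.toContinuousLinearEquiv :
      CTensor 𝕜 A A →L[𝕜] CTensor 𝕜 A A).comp (tmulL e))
  have hκ : ∀ y, δ.fst (κ y) = y := fun y => by
    change δ.fst (sliceLeft φ (H.T₁.symm (tmul e y))) = y
    rw [← h₁, H.T₁.apply_symm_apply, sliceLeft_tmul, hf, one_smul]
  have hκ' : ∀ y, δ.snd (κ' y) = y := fun y => by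
    change δ.snd (sliceLeft φ (H.T₃.symm (tmul e y))) = y
    rw [← h₃, H.T₃.apply_symm_apply, sliceLeft_tmul, hf, one_smul]
  have hinj : ∀ y, δ.fst y = 0 → y = 0 := fun y hy => hnd.2 y fun x => by
    rw [← hκ' x, δ.central, hy, mul_zero]
  let δ' : 𝓜(𝕜, A) := ⟨(κ, κ'), fun x y => by
    change κ' x * y = x * κ y
    conv_lhs => rw [← hκ y]
    rw [← δ.central, hκ']⟩
  refine ⟨⟨δ, δ', multiplier_ext hnd hκ, multiplier_ext hnd fun y => ?_⟩, rfl⟩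
  change κ (δ.fst y) = y
  rw [← sub_eq_zero]
  exact hinj _ (by rw [map_sub, hκ, sub_self])

omit hφ in
-- Apply φ ⊗ id ⊗ id to `pentagon` at a = e: each of the two coproducts in (Δ ⊗ id)Δ(e) contributes
-- one factor δ.
theorem T₄_modular (b c : A) :
    H.T₄ (tmul c (δ.fst b)) = mapT δ.fst δ.fst (H.T₄ (tmul c b)) := by
  have h := congrArg (sliceLeft φ) (H.pentagon hA e b c)
  have h2 : ∀ u, (sliceLeft φ).comp (H.T₁R u) = φ.smulRight (δ.fst u) := fun u =>
    ContinuousLinearMap.ext fun x => by simp [h₁]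
  have h3 : ∀ w, sliceLeft φ (H.doubleT₁ e w) = mapT δ.fst δ.fst w := fun w => by
    refine CTensor.congr_clm ((sliceLeft φ).comp (H.doubleT₁ e)) (mapT δ.fst δ.fst)
      (fun u v => ?_) w
    simp only [ContinuousLinearMap.comp_apply, doubleT₁_tmul]
    rw [sliceLeft_assocT, ← mapT_comp_id, h2, mapT_smulRight_id, h₁]
    simp [hf]
  rw [sliceLeft_mapT, ContinuousLinearMap.comp_id, h₁, h3] at h
  simpa [hf] using h

omit hφ in
theorem Δ_modular (a : A) : H.Δ (δ.fst a) = tensorM δ δ * H.Δ a := by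
  refine multiplier_ext (nondegenerate_ctensor hA) fun w => ?_
  refine CTensor.congr_clm (H.Δ (δ.fst a)).fst ((mapT δ.fst δ.fst).comp (H.Δ a).fst)
    (fun p q => ?_) w
  have h : δ.fst.comp (rm q) = (rm q).comp δ.fst :=
    ContinuousLinearMap.ext fun x => fst_mul hA.nondegenerateProduct δ x q
  rw [ContinuousLinearMap.comp_apply, H.Δ_fst_tmul hA, H.Δ_fst_tmul hA, H.rm_T₁_eq_T₄ hA,
    H.rm_T₁_eq_T₄ hA, H.T₄_modular hA hf h₁, mapT_mapT, mapT_mapT, h]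
  rfl

omit hφ in
theorem comulM_modular : H.comulM δ = tensorM δ δ := by
  have h := isExtensionAt_extendM hA H.map_mul H.nondegenerate δ
  refine multiplier_eq_of_mul_eq (nondegenerate_ctensor hA) H.nondegenerate fun a => ?_
  rw [← H.Δ_modular hA hf h₁, h.map_fst (nondegenerate_ctensor hA), comulM]

omit hφ in
theorem Δ_snd_modular (a : A) : H.Δ (δ.snd a) = H.Δ a * tensorM δ δ := by
  have h := isExtensionAt_extendM hA H.map_mul H.nondegenerate δ
  rw [← H.comulM_modular hA hf h₁, h.map_snd (nondegenerate_ctensor hA), comulM]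

omit hφ in
-- Evaluate (φ ⊗ ε)(Δ(e)(1 ⊗ a)) one leg at a time, in both orders.
theorem counit_fst_modular (a : A) : H.counit (δ.fst a) = H.counit a := by
  have h := apply_sliceLeft_eq φ H.counit (H.T₁ (tmul e a))
  rw [h₁, H.sliceRight_counit_T₁ hA hf] at h
  simpa [hf] using h

omit hφ in
theorem counit_snd_modular (a : A) : H.counit (δ.snd a) = H.counit a := by
  obtain ⟨b, hb⟩ := H.exists_counit_eq_one hA hf
  have h := congrArg H.counit (δ.central a b)
  rwa [H.counit_mul hA hf, H.counit_mul hA hf, H.counit_fst_modular hA hf h₁, hb, mul_one,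
    mul_one] at h

omit hφ in
theorem counitM_modular : H.counitM δ = 1 := by
  obtain ⟨b, hb⟩ := H.exists_counit_eq_one hA hf
  have h : ∃ n, IsExtensionAt (toM.comp H.counit) δ n := ⟨1, fun a b => by
    simp only [ContinuousLinearMap.comp_apply, H.counit_fst_modular hA hf h₁,
      H.counit_snd_modular hA hf h₁]
    exact ⟨rfl, rfl⟩⟩
  -- The chosen extension is evaluated at 1 directly, by testing it on `b` with ε(b) = 1.
  have h2 := (h.choose_spec b 1).1
  simp only [ContinuousLinearMap.comp_apply, H.counit_fst_modular hA hf h₁, toM_fst, hb,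
    mul_one] at h2
  rw [counitM, extendM, dif_pos h]
  exact h2

/-- T₁(δp ⊗ q) = (δ ⊗ δ)T₁(p ⊗ q) and ε(δp) = ε(p), inserted into the formula for S(a)b. -/
theorem antipode_fst_modular (a b : A) :
    H.antipode (δ.fst a) * δ.fst b = H.antipode a * b := by
  have hT : ∀ z, H.T₁ (mapT δ.fst iA z) = mapT δ.fst δ.fst (H.T₁ z) := fun z => by
    refine CTensor.congr_clm (H.T₁L.comp (mapT δ.fst iA)) ((mapT δ.fst δ.fst).comp H.T₁L)
      (fun p q => toM_injective (𝕜 := 𝕜) (nondegenerate_ctensor hA) ?_) z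
    have h := toM_fst_apply (nondegenerate_ctensor hA) (tensorM δ δ) (H.T₁ (tmul p q))
    rw [H.T₁_spec, ← mul_assoc, ← H.Δ_modular hA hf h₁, ← H.T₁_spec] at h
    simpa using h.symm
  have h : H.counit.comp δ.fst = H.counit :=
    ContinuousLinearMap.ext fun x => H.counit_fst_modular hA hf h₁ x
  rw [H.antipode_mul hA hφ hf, H.antipode_mul hA hφ hf, ← mapT_tmul δ.fst δ.fst]
  obtain ⟨z, hz⟩ := H.T₁.surjective (tmul a b)
  rw [← hz, ← hT, H.T₁.symm_apply_apply, H.T₁.symm_apply_apply, sliceLeft_mapT, h]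
  rfl

/-- T₁(pδ ⊗ δ'q) = Δ(p)(δ ⊗ δδ'q) = T₁(p ⊗ q)(δ ⊗ 1), combined with ε(pδ) = ε(p). -/
theorem antipode_snd_modular {δ' : 𝓜(𝕜, A)} (hδ : δ * δ' = 1) (a b : A) :
    H.antipode (δ.snd a) * b = δ'.fst (H.antipode a * b) := by
  have hnd := hA.nondegenerateProduct
  have hT : ∀ z, H.T₁ (mapT δ.snd δ'.fst z) = mapT δ.snd iA (H.T₁ z) := fun z => by
    refine CTensor.congr_clm (H.T₁L.comp (mapT δ.snd δ'.fst)) ((mapT δ.snd iA).comp H.T₁L)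
      (fun p q => toM_injective (𝕜 := 𝕜) (nondegenerate_ctensor hA) ?_) z
    have h : toM (mapT δ.snd iA (H.T₁ (tmul p q))) = toM (H.T₁ (tmul p q)) * tensorM δ 1 :=
      toM_snd_apply (nondegenerate_ctensor hA) (tensorM δ 1) (H.T₁ (tmul p q))
    simp only [ContinuousLinearMap.comp_apply, T₁L_apply, mapT_tmul, h]
    rw [H.T₁_spec, H.T₁_spec, H.Δ_snd_modular hA hf h₁, mul_assoc, mul_assoc, ← tensorM_mul,
      ← tensorM_mul, toM_fst_apply hnd, ← mul_assoc, hδ]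
    simp
  have h : H.counit.comp δ.snd = H.counit :=
    ContinuousLinearMap.ext fun x => H.counit_snd_modular hA hf h₁ x
  have h2 : (tmul (δ.snd a) b : CTensor 𝕜 A A) = mapT δ.snd iA (tmul a b) := by simp
  rw [H.antipode_mul hA hφ hf, H.antipode_mul hA hφ hf, h2]
  obtain ⟨z, hz⟩ := H.T₁.surjective (tmul a b)
  rw [← hz, ← hT, H.T₁.symm_apply_apply, H.T₁.symm_apply_apply, sliceLeft_mapT, h]

theorem antipodeM_modular {δ' : 𝓜(𝕜, A)} (hδ : δ * δ' = 1) : H.antipodeM δ = δ' := by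
  have hnd := hA.nondegenerateProduct
  have h : ∃ n, IsAntiExtensionAt (toM.comp H.antipode) δ n := by
    refine ⟨δ', fun a b => ⟨(H.antipode_snd_modular hA hφ hf h₁ hδ a b).symm, ?_⟩⟩
    change δ'.snd (b * H.antipode a) = b * H.antipode (δ.fst a)
    rw [snd_mul hnd]
    congr 1
    rw [← sub_eq_zero]
    refine hnd.1 _ fun c => ?_
    have hc : δ.fst (δ'.fst c) = c := congrArg (fun m : 𝓜(𝕜, A) => m.fst c) hδ
    rw [sub_mul, sub_eq_zero, δ'.central, ← H.antipode_fst_modular hA hφ hf h₁, hc]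
  rw [antipodeM, antiExtendM, dif_pos h]
  -- The chosen extension agrees with `δ'` on all products S(a)b, which suffices because S is onto.
  refine multiplier_ext hnd fun x => ?_
  rw [← sub_eq_zero]
  refine hnd.1 _ fun b => ?_
  obtain ⟨a, rfl⟩ := H.antipode_surjective hA hφ hf x
  rw [sub_mul, sub_eq_zero, ← fst_mul hnd, ← fst_mul hnd]
  exact ((h.choose_spec a b).1).trans (H.antipode_snd_modular hA hφ hf h₁ hδ a b)

end MultiplierBanachHopf

end NABanach

end

theorem mainTheorem6 {𝕜 A : Type*} [NontriviallyNormedField 𝕜] [IsUltrametricDist 𝕜]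
    [NonUnitalNormedRing A] [NormedSpace 𝕜 A] [SMulCommClass 𝕜 A A] [IsScalarTower 𝕜 A A]
    [IsUltrametricDist A] [CompleteSpace A]
    (hpolar : NABanach.IsPolar 𝕜 A) (hnd : NABanach.NondegenerateProduct A)
    (hbai : NABanach.HasBoundedApproximateIdentity A)
    (H : NABanach.MultiplierBanachHopf 𝕜 A)
    (φ : A →L[𝕜] 𝕜) (hφ : H.IsLeftInvariant φ) :
    ∃ δ : (𝓜(𝕜, A))ˣ,
      (∀ a, H.IsLeftSlice φ a (φ a • (δ : 𝓜(𝕜, A)))) ∧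
      H.comulM δ = NABanach.tensorM (δ : 𝓜(𝕜, A)) (δ : 𝓜(𝕜, A)) ∧
      H.counitM δ = 1 ∧
      H.antipodeM δ = ((δ⁻¹ : (𝓜(𝕜, A))ˣ) : 𝓜(𝕜, A)) ∧
      ∀ a, φ (H.antipode a) = φ ((δ : 𝓜(𝕜, A)).snd a) := by
  obtain ⟨e, hf⟩ : ∃ e, φ e = 1 := by
    obtain ⟨a, ha⟩ := DFunLike.ne_iff.1 hφ.1
    rw [_root_.zero_apply] at ha
    exact ⟨(φ a)⁻¹ • a, by rw [map_smul, smul_eq_mul, inv_mul_cancel₀ ha]⟩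
  have hinv : ∀ a b, NABanach.sliceRight φ (H.T₄ (NABanach.tmul b a)) = φ a • b :=
    fun a b => ((hφ.2 a b).1).symm
  obtain ⟨δ, h₁, h₃⟩ := H.exists_modular hbai hinv hf hpolar
  obtain ⟨δ, rfl⟩ := H.isUnit_modular hbai hf h₁ h₃
  refine ⟨δ, fun a b => ⟨?_, ?_⟩, H.comulM_modular hbai hf h₁, H.counitM_modular hbai hf h₁,
    H.antipodeM_modular hbai hinv hf h₁ δ.mul_inv, fun a => ?_⟩
  · rw [h₁, NABanach.sliceLeft_tmul, map_smul]
    rfl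
  · rw [h₃, NABanach.sliceLeft_tmul, map_smul]
    rfl
  -- At b = e the slice (φ ⊗ id)((1 ⊗ a)Δ(e)) is aδ.
  · have h := H.apply_sliceLeft_T₃ hbai hinv hf a e
    rw [h₃, NABanach.sliceLeft_tmul, hf, one_smul, mul_one] at h
    exact h.symm
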